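/- Corollary 1. Let $P,Q\in\mathbf{C}[x,y]$ be such that the Jacobian determinant $P_xQ_y-P_yQ_x$ is a nonzero constant. Suppose that the total degrees are $\deg P=Kd$ and $\deg Q=Ke$ with $\gcd(d,e)=1$ ($K,d,e$ natural numbers), and that $P$ and $Q$ are monic in $y$ up to constants, i.e. $$P(x,y)=Ay^{Kd}+\dots+a_1(x)y+a_0(x),\qquad Q(x,y)=By^{Ke}+\dots+b_1(x)y+b_0(x),$$ with nonzero constants $A,B\in\mathbf{C}$ and lower terms in $y$ having coefficients in $\mathbf{C}[x]$. Let $R_0(u,v)\in\mathbf{C}[u,v]$ be the leading coefficient of the resultant $$\mathrm{Res}_y(P-u,Q-v)=R_0(u,v)x^N+\dots+R_N(u,v),$$ viewed as a polynomial in $x$ with coefficients in $\mathbf{C}[u,v]$. Then there are a constant $0\ne C\in\mathbf{C}$, an integer $M\ge 0$ and coefficients $c_{ij}\in\mathbf{C}$ $(i,j\ge 0)$ such that $$R_0(u,v)=C\,(B^d u^e-A^e v^d)^M+\sum_{0\le id+je<Mde}c_{ij}u^iv^j .$$ -/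

import Mathlib

/-- The Jacobian determinant `P_x Q_y - P_y Q_x` of `P, Q ∈ ℂ[x, y]`
(variable `0` is `x`, variable `1` is `y`). -/
noncomputable def jacobianDet (P Q : MvPolynomial (Fin 2) ℂ) : MvPolynomial (Fin 2) ℂ :=
  MvPolynomial.pderiv 0 P * MvPolynomial.pderiv 1 Q
    - MvPolynomial.pderiv 1 P * MvPolynomial.pderiv 0 Q

/-- A polynomial `P ∈ ℂ[x, y]` regarded as a polynomial in `y` whose coefficients are polynomials
in `x` over a commutative `ℂ`-algebra `S`, that is, as an element of `S[x][y]`.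
For `S = ℂ` this is the usual identification of `ℂ[x, y]` with `ℂ[x][y]`. -/
noncomputable def asPolyInY (S : Type*) [CommRing S] [Algebra ℂ S]
    (P : MvPolynomial (Fin 2) ℂ) : Polynomial (Polynomial S) :=
  MvPolynomial.aeval ![Polynomial.C Polynomial.X, Polynomial.X] P

/-- The resultant `Res_y (P - u, Q - v)`, as a polynomial in `x` with coefficients in `ℂ[u, v]`.
In the coefficient ring `ℂ[u, v] = MvPolynomial (Fin 2) ℂ`, variable `0` is `u` and variable `1`
is `v`. -/
noncomputable def resultantY (P Q : MvPolynomial (Fin 2) ℂ) :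
    Polynomial (MvPolynomial (Fin 2) ℂ) :=
  Polynomial.resultant
    (asPolyInY (MvPolynomial (Fin 2) ℂ) P - Polynomial.C (Polynomial.C (MvPolynomial.X 0)))
    (asPolyInY (MvPolynomial (Fin 2) ℂ) Q - Polynomial.C (Polynomial.C (MvPolynomial.X 1)))

/-!
Let `F` be an irreducible factor of the leading coefficient `R₀`, and let `(u, v)` be a generic zero
of `F` in an algebraically closed extension `κ` of the ground field `k`. Generalized power series
in `t = 1/x` with coefficients in `κ` and real exponents form an algebraically closed field, so the
resultant is a product over its roots, and the vanishing of `R₀` at `(u, v)` produces a branch at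
infinity `x = 1/t`, `y = y(t)` along which `P → u` and `Q → v`.

Let `ξ` be the first coefficient of `y(t)` outside `k`, at exponent `q₀`, and let `φ` be the part of
`y(t)` below `q₀`. Expand `P` and `Q` at `y = φ + t ^ r X`. As the Jacobian is constant, a weighted
Wronskian of the two leading polynomials in `X` is constant for every radius `r`. While `r` moves
from `-∞` to `q₀`, this forces the `e`-th power of the one and the `d`-th power of the other to have
proportional top terms, with the same constant throughout. At `r = q₀` it follows that
`(u, v) = (p(ξ), q(ξ))` for polynomials `p`, `q` over `k` of degrees `d j`, `e j` whose leading
coefficients satisfy `B ^ d * lc(p) ^ e = A ^ e * lc(q) ^ d`.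

Hence `F` divides the resultant of `p(s) - u` and `q(s) - v` in `s`, whose top form for the weights
`d`, `e` divides a power of `B ^ d * u ^ e - A ^ e * v ^ d`. This form is irreducible because `d`
and `e` are coprime, and top forms are multiplicative, so the top form of `R₀` is a constant
multiple of a power of it.
-/

section

open Polynomial

section HahnSeries
variable {Γ R S : Type*}

section Zero
variable [LinearOrder Γ] [Zero Γ] [Zero R] {f : HahnSeries Γ R} {a : Γ}

theorem order_le_orderTop (f : HahnSeries Γ R) : (f.order : WithTop Γ) ≤ f.orderTop := by
  rcases eq_or_ne f 0 with rfl | hf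
  · simp
  · exact (HahnSeries.order_eq_orderTop_of_ne_zero hf).le

theorem le_order_of_le_orderTop (ha : a ≤ f.orderTop) (hf : f ≠ 0) : a ≤ f.order := by
  rwa [← WithTop.coe_le_coe, HahnSeries.order_eq_orderTop_of_ne_zero hf]

theorem order_eq_of_coeff_ne_zero (ha : a ≤ f.orderTop) (hf : f.coeff a ≠ 0) : f.order = a :=
  le_antisymm (HahnSeries.order_le_of_coeff_ne_zero hf)
    (le_order_of_le_orderTop ha (HahnSeries.ne_zero_of_coeff_ne_zero hf))

theorem leadingCoeff_eq_of_coeff_ne_zero (ha : a ≤ f.orderTop) (hf : f.coeff a ≠ 0) :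
    f.leadingCoeff = f.coeff a := by
  rw [HahnSeries.leadingCoeff_eq, order_eq_of_coeff_ne_zero ha hf]

end Zero

section Mul
variable [AddCommMonoid Γ] [LinearOrder Γ] [IsOrderedCancelAddMonoid Γ]
  [Semiring R] [Semiring S] {f g : HahnSeries Γ R} {a b : Γ}

theorem coeff_mul_add_of_le_orderTop (hf : a ≤ f.orderTop) (hg : b ≤ g.orderTop) :
    (f * g).coeff (a + b) = f.coeff a * g.coeff b := by
  rw [HahnSeries.coeff_mul]
  refine Finset.sum_eq_single (a, b) (fun ij hij hne => ?_) (fun h => ?_)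
  · obtain ⟨hi, hj, hij⟩ := Finset.mem_antidiagonal.mp hij
    have hai : a ≤ ij.1 := WithTop.coe_le_coe.mp
      (hf.trans (HahnSeries.orderTop_le_of_coeff_ne_zero hi))
    have hbj : b ≤ ij.2 := WithTop.coe_le_coe.mp
      (hg.trans (HahnSeries.orderTop_le_of_coeff_ne_zero hj))
    have := (add_eq_add_iff_eq_and_eq hai hbj).mp hij.symm
    exact absurd (Prod.ext this.1.symm this.2.symm) hne
  · by_contra hne
    exact h (Finset.mem_antidiagonal.mpr
      ⟨left_ne_zero_of_mul hne, right_ne_zero_of_mul hne, rfl⟩)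

theorem le_orderTop_pow (hf : a ≤ f.orderTop) (n : ℕ) :
    (n • a : Γ) ≤ (f ^ n).orderTop := by
  rw [WithTop.coe_nsmul]
  exact (nsmul_le_nsmul_right hf n).trans HahnSeries.orderTop_nsmul_le_orderTop_pow

theorem coeff_pow_nsmul_of_le_orderTop (hf : a ≤ f.orderTop) (n : ℕ) :
    (f ^ n).coeff (n • a) = f.coeff a ^ n := by
  induction n with
  | zero => simp
  | succ n ih =>
    rw [pow_succ, succ_nsmul, coeff_mul_add_of_le_orderTop (le_orderTop_pow hf n) hf, ih, pow_succ]

/-- The ring homomorphism applying a ring homomorphism to every coefficient of a Hahn series. -/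
def mapCoeff (φ : R →+* S) :
    HahnSeries Γ R →+* HahnSeries Γ S where
  toFun f := f.map φ
  map_zero' := by ext; simp
  map_one' := HahnSeries.map_one φ.toMonoidWithZeroHom
  map_add' f g := by ext; simp
  map_mul' f g := HahnSeries.map_mul (φ : R →ₙ+* S)

variable (φ : R →+* S)

@[simp] theorem coeff_mapCoeff (f : HahnSeries Γ R) (a : Γ) :
    (mapCoeff φ f).coeff a = φ (f.coeff a) := rfl

@[simp] theorem mapCoeff_single (a : Γ) (r : R) :
    mapCoeff φ (HahnSeries.single a r) = HahnSeries.single a (φ r) := by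
  ext b
  rcases eq_or_ne b a with rfl | hb <;> simp [*]

theorem le_orderTop_mapCoeff (f : HahnSeries Γ R) : f.orderTop ≤ (mapCoeff φ f).orderTop := by
  rw [HahnSeries.le_orderTop_iff_forall]
  intro a ha
  rw [coeff_mapCoeff, HahnSeries.coeff_eq_zero_of_lt_orderTop ha, map_zero]

end Mul

end HahnSeries

section Rescale
variable {Γ R S : Type*} [Field Γ] [LinearOrder Γ] [IsStrictOrderedRing Γ]
  [CommRing R] [CommRing S] {F : (HahnSeries Γ R)[X]} {δ : HahnSeries Γ R} {r w : Γ}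

/-- The substitution `T ↦ X t ^ r` turning a polynomial over generalized power series in `t` into
a generalized power series with polynomial coefficients. The order of `rescale r F` is the Gauss
order of `F` on the disc of radius `t ^ r`, its leading coefficient the reduction of `F` there. -/
noncomputable def rescale (r : Γ) : (HahnSeries Γ R)[X] →+* HahnSeries Γ R[X] :=
  eval₂RingHom (mapCoeff C) (HahnSeries.single r X)

theorem rescale_apply (r : Γ) (F : (HahnSeries Γ R)[X]) :
    rescale r F = F.eval₂ (mapCoeff C) (HahnSeries.single r X) := rfl

@[simp] theorem rescale_C (r : Γ) (a : HahnSeries Γ R) : rescale r (C a) = mapCoeff C a := by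
  simp [rescale]

@[simp] theorem rescale_X (r : Γ) :
    rescale r (X : (HahnSeries Γ R)[X]) = HahnSeries.single r X := by
  simp [rescale]

theorem coeff_coeff_rescale (r : Γ) (F : (HahnSeries Γ R)[X]) (w : Γ) (i : ℕ) :
    ((rescale r F).coeff w).coeff i = (F.coeff i).coeff (w - i * r) := by
  induction F using Polynomial.induction_on' with
  | add F G hF hG => simp [hF, hG]
  | monomial n a =>
    rw [rescale_apply, eval₂_monomial, HahnSeries.single_pow, HahnSeries.coeff_mul_single,
      coeff_mapCoeff, coeff_C_mul_X_pow, nsmul_eq_mul, coeff_monomial]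
    rcases eq_or_ne n i with rfl | h
    · simp
    · simp [h, h.symm]

theorem le_orderTop_rescale_iff :
    w ≤ (rescale r F).orderTop ↔ ∀ i : ℕ, ((w - i * r : Γ) : WithTop Γ) ≤ (F.coeff i).orderTop := by
  simp only [HahnSeries.le_orderTop_iff_forall, WithTop.coe_lt_coe]
  refine ⟨fun h i v hv => ?_, fun h v hv => ?_⟩
  · have := congrArg (coeff · i) (h (v + i * r) (by linarith : v + i * r < w))
    simpa [coeff_coeff_rescale] using this
  · ext i
    rw [coeff_coeff_rescale, h i _ (by linarith), coeff_zero]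

theorem rescale_injective (r : Γ) :
    Function.Injective (rescale r : (HahnSeries Γ R)[X] → HahnSeries Γ R[X]) := by
  rw [injective_iff_map_eq_zero]
  intro F hF
  ext i w
  have := coeff_coeff_rescale r F (w + i * r) i
  simpa [hF] using this.symm

theorem leadingCoeff_rescale_ne_zero (hF : F ≠ 0) (r : Γ) : (rescale r F).leadingCoeff ≠ 0 := by
  rwa [HahnSeries.leadingCoeff_ne_zero, Ne, map_eq_zero_iff _ (rescale_injective r)]

theorem coeff_leadingCoeff_rescale (r : Γ) (F : (HahnSeries Γ R)[X]) (i : ℕ) :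
    (rescale r F).leadingCoeff.coeff i = (F.coeff i).coeff ((rescale r F).order - i * r) := by
  rw [HahnSeries.leadingCoeff_eq, coeff_coeff_rescale]

theorem order_rescale_le {i : ℕ} (hi : F.coeff i ≠ 0) (r : Γ) :
    (rescale r F).order ≤ (F.coeff i).order + i * r := by
  have := le_order_of_le_orderTop
    (le_orderTop_rescale_iff.mp (order_le_orderTop (rescale r F)) i) hi
  linarith

theorem rescale_map (φ : R →+* S) (r : Γ) (F : (HahnSeries Γ R)[X]) :
    rescale r (F.map (mapCoeff φ)) = mapCoeff (mapRingHom φ) (rescale r F) := by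
  ext w i
  simp [coeff_coeff_rescale]

theorem coeff_rescale_taylor (hF : w ≤ (rescale r F).orderTop) (hδ : r ≤ δ.orderTop) :
    (rescale r (taylor δ F)).coeff w = taylor (δ.coeff r) ((rescale r F).coeff w) := by
  have hX : (rescale r (X + C δ)).coeff r = X + C (δ.coeff r) := by simp
  have hXr : r ≤ (rescale r (X + C δ)).orderTop := by
    rw [map_add, rescale_X, rescale_C]
    exact (le_min HahnSeries.orderTop_single_le (hδ.trans (le_orderTop_mapCoeff C δ))).trans
      HahnSeries.min_orderTop_le_orderTop_add
  rw [le_orderTop_rescale_iff] at hF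
  have hmono (i : ℕ) : (rescale r (taylor δ (monomial i (F.coeff i)))).coeff w =
      taylor (δ.coeff r) ((rescale r (monomial i (F.coeff i))).coeff w) := by
    have hC : (w - i * r : Γ) ≤ (mapCoeff C (F.coeff i) : HahnSeries Γ R[X]).orderTop :=
      (hF i).trans (le_orderTop_mapCoeff C _)
    have hw : w = (w - i * r) + i • r := by simp
    have h1 : (rescale r (monomial i (F.coeff i))).coeff w =
        C ((F.coeff i).coeff (w - i * r)) * X ^ i := by
      rw [rescale_apply, eval₂_monomial, HahnSeries.single_pow, HahnSeries.coeff_mul_single,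
        nsmul_eq_mul, coeff_mapCoeff]
    rw [h1, taylor_monomial, map_mul, rescale_C, map_pow, hw,
      coeff_mul_add_of_le_orderTop hC (le_orderTop_pow hXr i), coeff_pow_nsmul_of_le_orderTop hXr,
      hX, coeff_mapCoeff, ← hw]
    simp
  rw [F.as_sum_support]
  simp only [map_sum, HahnSeries.coeff_sum, hmono]

theorem le_orderTop_rescale_taylor (hF : w ≤ (rescale r F).orderTop) (hδ : r ≤ δ.orderTop) :
    w ≤ (rescale r (taylor δ F)).orderTop := by
  rw [HahnSeries.le_orderTop_iff_forall]
  intro v hv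
  rw [coeff_rescale_taylor (hv.le.trans hF) hδ,
    HahnSeries.coeff_eq_zero_of_lt_orderTop (hv.trans_le hF), map_zero]

theorem coeff_eval_of_le_orderTop (hF : w ≤ (rescale r F).orderTop) (hδ : r ≤ δ.orderTop) :
    (F.eval δ).coeff w = ((rescale r F).coeff w).eval (δ.coeff r) := by
  rw [← taylor_coeff_zero, ← taylor_coeff_zero, ← coeff_rescale_taylor hF hδ, coeff_coeff_rescale]
  simp

theorem le_orderTop_eval (hF : w ≤ (rescale r F).orderTop) (hδ : r ≤ δ.orderTop) :
    w ≤ (F.eval δ).orderTop := by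
  have := le_orderTop_rescale_iff.mp (le_orderTop_rescale_taylor hF hδ) 0
  simpa [taylor_coeff_zero] using this

theorem leadingCoeff_rescale_taylor (F : (HahnSeries Γ R)[X]) (hδ : r ≤ δ.orderTop) :
    (rescale r (taylor δ F)).leadingCoeff = taylor (δ.coeff r) (rescale r F).leadingCoeff := by
  rcases eq_or_ne F 0 with rfl | hF0
  · simp
  have hF := order_le_orderTop (rescale r F)
  have hc := coeff_rescale_taylor hF hδ
  rw [← HahnSeries.leadingCoeff_eq] at hc
  rw [leadingCoeff_eq_of_coeff_ne_zero (le_orderTop_rescale_taylor hF hδ), hc]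
  rw [hc, Ne, taylor_eq_zero]
  exact leadingCoeff_rescale_ne_zero hF0 r

end Rescale

section RootDisc
variable {Γ k : Type*} [Field Γ] [LinearOrder Γ] [IsStrictOrderedRing Γ] [Field k]
  {g : (HahnSeries Γ k)[X]} {q : Γ}

/-- The disc of radius `t ^ q` around `0` contains a root of `g`, as read off the Newton polygon:
the reduction of `g` on that disc is not constant. -/
def HasRootDisc (g : (HahnSeries Γ k)[X]) (q : Γ) : Prop :=
  (rescale q g).leadingCoeff.natDegree ≠ 0

theorem HasRootDisc.taylor (h : HasRootDisc g q) {δ : HahnSeries Γ k} (hδ : q ≤ δ.orderTop) :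
    HasRootDisc (taylor δ g) q := by
  rwa [HasRootDisc, leadingCoeff_rescale_taylor g hδ, natDegree_taylor]

theorem HasRootDisc.exists_le (h0 : g.coeff 0 ≠ 0) (h : HasRootDisc g q) :
    ∃ i ∈ g.support.erase 0, q ≤ ((g.coeff 0).order - (g.coeff i).order) / i := by
  set n := (rescale q g).leadingCoeff.natDegree
  have hn : (g.coeff n).coeff ((rescale q g).order - n * q) ≠ 0 := by
    rw [← coeff_leadingCoeff_rescale, coeff_natDegree, Ne, leadingCoeff_eq_zero]
    intro h'
    rw [HasRootDisc, h', natDegree_zero] at h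
    exact h rfl
  have hn0 : (0 : Γ) < n := by exact_mod_cast Nat.pos_of_ne_zero h
  refine ⟨n, Finset.mem_erase.mpr
    ⟨h, mem_support_iff.mpr (HahnSeries.ne_zero_of_coeff_ne_zero hn)⟩, ?_⟩
  have := HahnSeries.order_le_of_coeff_ne_zero hn
  have := order_rescale_le h0 q
  rw [le_div_iff₀ hn0]
  push_cast at this
  linarith

theorem hasRootDisc_of_le {i : ℕ} (hi : i ∈ g.support.erase 0)
    (hq : q ≤ ((g.coeff 0).order - (g.coeff i).order) / i) : HasRootDisc g q := by
  intro hdeg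
  obtain ⟨hi0, hi⟩ := Finset.mem_erase.mp hi
  rw [mem_support_iff] at hi
  have hipos : (0 : Γ) < i := by exact_mod_cast Nat.pos_of_ne_zero hi0
  rw [le_div_iff₀ hipos] at hq
  have hconst : (rescale q g).leadingCoeff.coeff 0 ≠ 0 := by
    intro h
    refine leadingCoeff_rescale_ne_zero (F := g) (by rintro rfl; exact hi rfl) q ?_
    rw [eq_C_of_natDegree_eq_zero hdeg, h, C_0]
  rw [coeff_leadingCoeff_rescale] at hconst
  have h0 := HahnSeries.order_le_of_coeff_ne_zero hconst
  have heq : (g.coeff i).order = (rescale q g).order - i * q := by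
    have := order_rescale_le hi q
    push_cast at h0
    linarith
  refine hi (HahnSeries.coeff_order_eq_zero.mp ?_)
  rw [heq, ← coeff_leadingCoeff_rescale]
  exact coeff_eq_zero_of_natDegree_lt (hdeg ▸ Nat.pos_of_ne_zero hi0)

theorem exists_isGreatest_hasRootDisc (h0 : g.coeff 0 ≠ 0) (h : HasRootDisc g q) :
    ∃ m, IsGreatest {r | HasRootDisc g r} m := by
  obtain ⟨j, hj, -⟩ := h.exists_le h0
  obtain ⟨n, hn, hmax⟩ := (g.support.erase 0).exists_max_image
    (fun i => ((g.coeff 0).order - (g.coeff i).order) / (i : Γ)) ⟨j, hj⟩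
  refine ⟨_, hasRootDisc_of_le hn le_rfl, fun r hr => ?_⟩
  obtain ⟨i, hi, hri⟩ := HasRootDisc.exists_le h0 hr
  exact hri.trans (hmax i hi)

/-- A step of Newton's algorithm: the new term is a root of the reduction. -/
theorem HasRootDisc.exists_gt_taylor_single [IsAlgClosed k] (h : HasRootDisc g q)
    (hroot : ∀ z, g.eval z ≠ 0) :
    ∃ c, ∃ q' > q, HasRootDisc (Polynomial.taylor (HahnSeries.single q c) g) q' := by
  obtain ⟨c, hc⟩ := IsAlgClosed.exists_root (rescale q g).leadingCoeff
    (fun h' => h (natDegree_eq_of_degree_eq_some h'))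
  set G := Polynomial.taylor (HahnSeries.single q c) g
  have hred : (rescale q G).leadingCoeff = Polynomial.taylor c (rescale q g).leadingCoeff := by
    simpa using leadingCoeff_rescale_taylor g (HahnSeries.orderTop_single_le (a := q) (r := c))
  have hG0 : G.coeff 0 ≠ 0 := by
    rw [taylor_coeff_zero]
    exact hroot _
  have hred0 : (G.coeff 0).coeff (rescale q G).order = 0 := by
    have := coeff_leadingCoeff_rescale q G 0
    rw [hred, taylor_coeff_zero, hc.eq_zero] at this
    simpa using this.symm
  have hlt : (rescale q G).order < (G.coeff 0).order := by
    have hle := order_rescale_le hG0 q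
    rw [Nat.cast_zero, zero_mul, add_zero] at hle
    refine hle.lt_of_ne fun heq => hG0 (HahnSeries.coeff_order_eq_zero.mp ?_)
    rwa [← heq]
  set n := (rescale q G).leadingCoeff.natDegree with hn
  have hn0 : n ≠ 0 := by
    rw [hn, hred, natDegree_taylor]
    exact h
  have hGn : (G.coeff n).coeff ((rescale q G).order - n * q) ≠ 0 := by
    rw [← coeff_leadingCoeff_rescale, hn, coeff_natDegree, Ne, leadingCoeff_eq_zero]
    intro h'
    rw [h', natDegree_zero] at hn
    exact hn0 hn
  have hnpos : (0 : Γ) < n := by exact_mod_cast Nat.pos_of_ne_zero hn0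
  refine ⟨c, ((G.coeff 0).order - (G.coeff n).order) / n, ?_, hasRootDisc_of_le
    (Finset.mem_erase.mpr
      ⟨hn0, mem_support_iff.mpr (HahnSeries.ne_zero_of_coeff_ne_zero hGn)⟩) le_rfl⟩
  have := HahnSeries.order_le_of_coeff_ne_zero hGn
  rw [gt_iff_lt, lt_div_iff₀ hnpos]
  linarith

end RootDisc

section AlgClosed
variable {Γ : Type*}

/-- Spherical completeness of the field of generalized power series. -/
theorem exists_forall_le_orderTop_sub [LinearOrder Γ] {ι R : Type*} [AddGroup R]
    (y : ι → HahnSeries Γ R) (q : ι → Γ)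
    (h : ∀ a b, q a ≤ q b → q a ≤ (y b - y a).orderTop) :
    ∃ z, ∀ a, q a ≤ (z - y a).orderTop := by
  classical
  have coeff_eq_of_le {a b s} (hab : q a ≤ q b) (hs : s < q a) :
      (y b).coeff s = (y a).coeff s := by
    have := HahnSeries.le_orderTop_iff_forall.mp (h a b hab) s (WithTop.coe_lt_coe.mpr hs)
    rwa [HahnSeries.coeff_sub, sub_eq_zero] at this
  have coeff_eq {a b s} (ha : s < q a) (hb : s < q b) : (y a).coeff s = (y b).coeff s :=
    (le_total (q a) (q b)).elim (fun hab => (coeff_eq_of_le hab ha).symm)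
      (fun hab => coeff_eq_of_le hab hb)
  let z : Γ → R := fun s => if hs : ∃ a, s < q a then (y hs.choose).coeff s else 0
  have hz {a s} (ha : s < q a) : z s = (y a).coeff s := by
    have hs : ∃ a, s < q a := ⟨a, ha⟩
    simp only [z, dif_pos hs]
    exact coeff_eq hs.choose_spec ha
  have hwf : (Function.support z).IsWF := by
    rw [Set.isWF_iff_no_descending_seq]
    intro f hf hsub
    obtain ⟨a, ha⟩ : ∃ a, f 0 < q a := by
      by_contra h0
      exact hsub 0 (dif_neg h0)
    refine Set.isWF_iff_no_descending_seq.mp (y a).isWF_support f hf fun n => ?_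
    have hn : z (f n) ≠ 0 := hsub n
    rwa [hz ((hf.antitone (Nat.zero_le n)).trans_lt ha)] at hn
  refine ⟨⟨z, hwf.isPWO⟩, fun a => HahnSeries.le_orderTop_iff_forall.mpr fun s hs => ?_⟩
  rw [HahnSeries.coeff_sub, sub_eq_zero]
  exact hz (WithTop.coe_lt_coe.mp hs)

variable {k : Type*} [Field Γ] [LinearOrder Γ] [IsStrictOrderedRing Γ] [Field k]

/-- A disc around `p.center` of radius `t ^ p.radius` in which the Newton polygon shows a root of
`f`; the order `p ≤ p'` says that the disc `p'` is contained in the disc `p`. -/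
structure RootDisc (f : (HahnSeries Γ k)[X]) where
  center : HahnSeries Γ k
  radius : Γ
  hasRootDisc : HasRootDisc (taylor center f) radius

namespace RootDisc
variable {f : (HahnSeries Γ k)[X]}

instance : LE (RootDisc f) where
  le p p' := p.radius ≤ p'.radius ∧ p.radius ≤ (p'.center - p.center).orderTop

protected theorem le_trans {p₁ p₂ p₃ : RootDisc f} (h₁₂ : p₁ ≤ p₂) (h₂₃ : p₂ ≤ p₃) : p₁ ≤ p₃ := by
  refine ⟨h₁₂.1.trans h₂₃.1, ?_⟩
  rw [← sub_add_sub_cancel]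
  exact (le_min ((WithTop.coe_le_coe.mpr h₁₂.1).trans h₂₃.2) h₁₂.2).trans
    HahnSeries.min_orderTop_le_orderTop_add

theorem exists_upperBound (hroot : ∀ z, f.eval z ≠ 0) {c : Set (RootDisc f)}
    (hc : IsChain (· ≤ ·) c) (hne : c.Nonempty) : ∃ m, ∀ p ∈ c, p ≤ m := by
  have hcompat (p p' : c) (hle : p.1.radius ≤ p'.1.radius) :
      p.1.radius ≤ (p'.1.center - p.1.center).orderTop := by
    rcases eq_or_ne p p' with rfl | hpp'
    · simp
    rcases hc p.2 p'.2 (Subtype.coe_injective.ne hpp') with h | h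
    · exact h.2
    · rw [← HahnSeries.orderTop_neg, neg_sub]
      exact (WithTop.coe_le_coe.mpr hle).trans h.2
  obtain ⟨z, hz⟩ := exists_forall_le_orderTop_sub (fun p : c => p.1.center)
    (fun p : c => p.1.radius) hcompat
  have hmem (p : RootDisc f) (hp : p ∈ c) : HasRootDisc (taylor z f) p.radius := by
    have := p.hasRootDisc.taylor (hz ⟨p, hp⟩)
    rwa [taylor_taylor, sub_add_cancel] at this
  obtain ⟨p, hp⟩ := hne
  obtain ⟨m, hm, hmax⟩ := exists_isGreatest_hasRootDisc
    (by rw [taylor_coeff_zero]; exact hroot z) (hmem p hp)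
  exact ⟨⟨z, m, hm⟩, fun p hp => ⟨hmax (hmem p hp), hz ⟨p, hp⟩⟩⟩

end RootDisc

theorem isAlgClosed_hahnSeries [IsAlgClosed k] : IsAlgClosed (HahnSeries Γ k) := by
  refine IsAlgClosed.of_exists_root _ fun f hmonic hirr => ?_
  by_contra! hroot
  have : Nonempty (RootDisc f) := by
    refine ⟨⟨0, (f.coeff 0).order / f.natDegree, ?_⟩⟩
    rw [taylor_zero]
    refine hasRootDisc_of_le (i := f.natDegree)
      (Finset.mem_erase.mpr ⟨hirr.natDegree_pos.ne', ?_⟩) ?_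
    · simp [hmonic.ne_zero]
    · simp [hmonic.coeff_natDegree]
  obtain ⟨m, hm⟩ := exists_maximal_of_nonempty_chains_bounded
    (fun c hc hne => RootDisc.exists_upperBound hroot hc hne) RootDisc.le_trans
  obtain ⟨c, q, hlt, hq⟩ := m.hasRootDisc.exists_gt_taylor_single
    fun z => by rw [taylor_eval]; exact hroot _
  rw [taylor_taylor] at hq
  have hle := hm ⟨HahnSeries.single m.radius c + m.center, q, hq⟩
    ⟨hlt.le, by simpa using HahnSeries.orderTop_single_le⟩
  exact absurd hle.1 hlt.not_ge

end AlgClosed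

section Derivations
variable {Γ A : Type*}

/-- The Euler operator `t ^ s ↦ ℓ(s) t ^ s` on generalized power series. -/
def eulerOperator [AddZeroClass Γ] [PartialOrder Γ] [CommSemiring A] (ℓ : Γ →+ A) :
    HahnSeries Γ A →+ HahnSeries Γ A where
  toFun f := ⟨fun s => ℓ s * f.coeff s, f.isPWO_support.mono fun _ hs => right_ne_zero_of_mul hs⟩
  map_zero' := by ext s; simp
  map_add' f g := by ext s; simp [mul_add]

@[simp] theorem coeff_eulerOperator [AddZeroClass Γ] [PartialOrder Γ] [CommSemiring A] (ℓ : Γ →+ A)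
    (f : HahnSeries Γ A) (s : Γ) : (eulerOperator ℓ f).coeff s = ℓ s * f.coeff s := rfl

/-- The derivative in `X`, coefficient by coefficient, of a generalized power series over `A[X]`. -/
noncomputable def coeffDerivative [PartialOrder Γ] [CommSemiring A] :
    HahnSeries Γ A[X] →+ HahnSeries Γ A[X] where
  toFun f := f.map derivative
  map_zero' := by ext s : 2; simp
  map_add' f g := by ext s : 2; simp

@[simp] theorem coeff_coeffDerivative [PartialOrder Γ] [CommSemiring A] (f : HahnSeries Γ A[X])
    (s : Γ) : (coeffDerivative f).coeff s = derivative (f.coeff s) := rfl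

@[simp] theorem eulerOperator_single [AddZeroClass Γ] [PartialOrder Γ] [CommSemiring A]
    (ℓ : Γ →+ A) (s : Γ) (a : A) :
    eulerOperator ℓ (HahnSeries.single s a) = HahnSeries.single s (ℓ s * a) := by
  ext u
  rcases eq_or_ne u s with rfl | hu <;> simp [*]

@[simp] theorem coeffDerivative_single [PartialOrder Γ] [CommSemiring A] (s : Γ) (p : A[X]) :
    coeffDerivative (HahnSeries.single s p) = HahnSeries.single s (derivative p) := by
  ext u : 2
  rcases eq_or_ne u s with rfl | hu <;> simp [*]

theorem le_orderTop_eulerOperator [AddCommMonoid Γ] [LinearOrder Γ] [CommSemiring A] (ℓ : Γ →+ A)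
    (f : HahnSeries Γ A) : f.orderTop ≤ (eulerOperator ℓ f).orderTop :=
  HahnSeries.le_orderTop_iff_forall.mpr fun _ hs => by
    rw [coeff_eulerOperator, HahnSeries.coeff_eq_zero_of_lt_orderTop hs, mul_zero]

theorem le_orderTop_coeffDerivative [LinearOrder Γ] [CommSemiring A] (f : HahnSeries Γ A[X]) :
    f.orderTop ≤ (coeffDerivative f).orderTop :=
  HahnSeries.le_orderTop_iff_forall.mpr fun _ hs => by
    rw [coeff_coeffDerivative, HahnSeries.coeff_eq_zero_of_lt_orderTop hs, derivative_zero]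

variable [AddCommMonoid Γ] [LinearOrder Γ] [IsOrderedCancelAddMonoid Γ] [CommSemiring A]

theorem eulerOperator_mul (ℓ : Γ →+ A) (f g : HahnSeries Γ A) :
    eulerOperator ℓ (f * g) = eulerOperator ℓ f * g + f * eulerOperator ℓ g := by
  ext s
  have hsupp (f : HahnSeries Γ A) : (eulerOperator ℓ f).support ⊆ f.support :=
    fun s hs => right_ne_zero_of_mul hs
  rw [HahnSeries.coeff_add, HahnSeries.coeff_mul_left' f.isPWO_support (hsupp f),
    HahnSeries.coeff_mul_right' g.isPWO_support (hsupp g), coeff_eulerOperator,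
    HahnSeries.coeff_mul, Finset.mul_sum, ← Finset.sum_add_distrib]
  refine Finset.sum_congr rfl fun ij hij => ?_
  rw [← (Finset.mem_antidiagonal.mp hij).2.2, map_add, coeff_eulerOperator, coeff_eulerOperator]
  ring

theorem coeffDerivative_mul (f g : HahnSeries Γ A[X]) :
    coeffDerivative (f * g) = coeffDerivative f * g + f * coeffDerivative g := by
  ext s : 2
  have hsupp (f : HahnSeries Γ A[X]) : (coeffDerivative f).support ⊆ f.support :=
    fun s hs h => hs (by simp [h])
  rw [HahnSeries.coeff_add, HahnSeries.coeff_mul_left' f.isPWO_support (hsupp f),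
    HahnSeries.coeff_mul_right' g.isPWO_support (hsupp g), coeff_coeffDerivative,
    HahnSeries.coeff_mul, derivative_sum, ← Finset.sum_add_distrib]
  exact Finset.sum_congr rfl fun _ _ => derivative_mul

end Derivations

section ChainRule
variable {R S : Type*}

theorem leibniz_eval₂ {σ : Type*} [Fintype σ] [CommSemiring R] [CommSemiring S] {D : S →+ S}
    {f : R →+* S} (hD : ∀ a b, D (a * b) = D a * b + a * D b) (hf : ∀ c, D (f c) = 0)
    (v : σ → S) (P : MvPolynomial σ R) :
    D (P.eval₂ f v) = ∑ i, (MvPolynomial.pderiv i P).eval₂ f v * D (v i) := by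
  classical
  induction P using MvPolynomial.induction_on with
  | C a => simp [hf]
  | add P Q hP hQ => simp [hP, hQ, add_mul, Finset.sum_add_distrib]
  | mul_X P i hP =>
    simp only [MvPolynomial.eval₂_mul, MvPolynomial.eval₂_X, hD, hP, Finset.sum_mul,
      Derivation.leibniz, smul_eq_mul, MvPolynomial.eval₂_add, MvPolynomial.pderiv_X, add_mul,
      Finset.sum_add_distrib]
    rw [add_comm]
    congr 1
    · rw [Finset.sum_eq_single i (fun j _ hj => by simp [hj.symm]) (by simp)]
      simp
    · exact Finset.sum_congr rfl fun j _ => by ring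

/-- The Jacobian determinant of a pair of bivariate polynomials, over any coefficient ring. -/
noncomputable def jacobian [CommRing R] (P Q : MvPolynomial (Fin 2) R) : MvPolynomial (Fin 2) R :=
  MvPolynomial.pderiv 0 P * MvPolynomial.pderiv 1 Q -
    MvPolynomial.pderiv 1 P * MvPolynomial.pderiv 0 Q

theorem jacobian_eval₂ [CommRing R] [CommRing S] {D D' : S →+ S} {f : R →+* S}
    (hD : ∀ a b, D (a * b) = D a * b + a * D b) (hf : ∀ c, D (f c) = 0)
    (hD' : ∀ a b, D' (a * b) = D' a * b + a * D' b) (hf' : ∀ c, D' (f c) = 0)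
    (v : Fin 2 → S) (P Q : MvPolynomial (Fin 2) R) :
    D (P.eval₂ f v) * D' (Q.eval₂ f v) - D' (P.eval₂ f v) * D (Q.eval₂ f v) =
      (jacobian P Q).eval₂ f v *
        (D (v 0) * D' (v 1) - D' (v 0) * D (v 1)) := by
  simp only [jacobian, leibniz_eval₂ hD hf, leibniz_eval₂ hD' hf', Fin.sum_univ_two,
    MvPolynomial.eval₂_sub, MvPolynomial.eval₂_mul]
  ring

end ChainRule

section Expansion
variable {Γ k : Type*} [Field Γ] [LinearOrder Γ] [IsStrictOrderedRing Γ]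

/-- The expansion of a bivariate polynomial at infinity along `x = t⁻¹`, `y = φ(t) + T`. -/
noncomputable def expandAt [CommRing k] (φ : HahnSeries Γ k) :
    MvPolynomial (Fin 2) k →+* (HahnSeries Γ k)[X] :=
  MvPolynomial.eval₂Hom (C.comp HahnSeries.C) ![C (HahnSeries.single (-1) 1), X + C φ]

theorem rescale_expandAt [CommRing k] (r : Γ) (φ : HahnSeries Γ k) (P : MvPolynomial (Fin 2) k) :
    rescale r (expandAt φ P) = P.eval₂ (HahnSeries.C.comp C)
      ![HahnSeries.single (-1) 1, HahnSeries.single r X + mapCoeff C φ] := by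
  rw [expandAt, MvPolynomial.coe_eval₂Hom, MvPolynomial.hom_eval₂]
  congr 1
  · ext c : 1; simp [HahnSeries.C_apply]
  · ext i : 1; fin_cases i <;> simp

theorem exists_addMonoidHom_ne_zero [DivisionRing k] [CharZero k] {b : Γ} (hb : b ≠ 0) :
    ∃ ℓ : Γ →+ k, ℓ b ≠ 0 := by
  have : ∃ f : Module.Dual ℚ Γ, f b ≠ 0 := by
    by_contra! h
    exact hb ((Module.forall_dual_apply_eq_zero_iff ℚ b).mp h)
  obtain ⟨f, hf⟩ := this
  exact ⟨(algebraMap ℚ k).toAddMonoidHom.comp f.toAddMonoidHom, by simpa using hf⟩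

theorem exists_weighted_wronskian_eq_C [CommRing k] {φ : HahnSeries Γ k}
    {P Q : MvPolynomial (Fin 2) k} (ℓ : Γ →+ k)
    (hJ : ∃ c, jacobian P Q = MvPolynomial.C c) {r a b : Γ}
    (ha : a ≤ (rescale r (expandAt φ P)).orderTop) (hb : b ≤ (rescale r (expandAt φ Q)).orderTop) :
    ∃ c, C (ℓ a) * ((rescale r (expandAt φ P)).coeff a *
          derivative ((rescale r (expandAt φ Q)).coeff b)) -
        C (ℓ b) * (derivative ((rescale r (expandAt φ P)).coeff a) *
          (rescale r (expandAt φ Q)).coeff b) = C c := by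
  obtain ⟨c, hc⟩ := hJ
  let ℓ' : Γ →+ k[X] := (C : k →+* k[X]).toAddMonoidHom.comp ℓ
  have hℓ' (s : Γ) : ℓ' s = C (ℓ s) := rfl
  have hφ : coeffDerivative (mapCoeff C φ) = 0 := by ext s : 2; simp
  have hjac := jacobian_eval₂ (D := eulerOperator ℓ') (D' := coeffDerivative)
    (f := (HahnSeries.C : k[X] →+* HahnSeries Γ k[X]).comp C)
    (eulerOperator_mul ℓ') (fun c => by simp [HahnSeries.C_apply])
    coeffDerivative_mul (fun c => by simp [HahnSeries.C_apply])
    ![HahnSeries.single (-1) 1, HahnSeries.single r X + mapCoeff C φ] P Q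
  replace hjac := congrArg (fun h => h.coeff (a + b)) hjac
  simp only [← rescale_expandAt, hc, MvPolynomial.eval₂_C, HahnSeries.coeff_sub] at hjac
  rw [coeff_mul_add_of_le_orderTop (ha.trans (le_orderTop_eulerOperator ℓ' _))
      (hb.trans (le_orderTop_coeffDerivative _)),
    coeff_mul_add_of_le_orderTop (ha.trans (le_orderTop_coeffDerivative _))
      (hb.trans (le_orderTop_eulerOperator ℓ' _))] at hjac
  simp only [Matrix.cons_val_zero, Matrix.cons_val_one, eulerOperator_single,
    coeffDerivative_single, map_add, hφ, derivative_X, derivative_one, HahnSeries.single_eq_zero,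
    add_zero, RingHom.comp_apply, HahnSeries.C_apply, zero_mul, sub_zero,
    HahnSeries.single_mul_single, coeff_eulerOperator, coeff_coeffDerivative, hℓ', mul_one] at hjac
  by_cases hab : a + b = 0 + (-1 + r)
  · rw [hab, HahnSeries.coeff_single_same] at hjac
    exact ⟨c * ℓ (-1), by rw [C_mul, ← hjac]; ring⟩
  · rw [HahnSeries.coeff_single_of_ne hab] at hjac
    exact ⟨0, by rw [C_0, ← hjac]; ring⟩

theorem exists_wronskian_leadingCoeff_eq_C [Field k] [CharZero k] {φ : HahnSeries Γ k}
    {P Q : MvPolynomial (Fin 2) k}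
    (hJ : ∃ c, jacobian P Q = MvPolynomial.C c) {d e : ℕ} {r a b : Γ}
    (ha : a ≤ (rescale r (expandAt φ P)).orderTop) (hb : b ≤ (rescale r (expandAt φ Q)).orderTop)
    (hab : e * a = d * b) (hb0 : b ≠ 0) :
    ∃ c, C (d : k) * ((rescale r (expandAt φ P)).coeff a *
          derivative ((rescale r (expandAt φ Q)).coeff b)) -
        C (e : k) * (derivative ((rescale r (expandAt φ P)).coeff a) *
          (rescale r (expandAt φ Q)).coeff b) = C c := by
  obtain ⟨ℓ, hℓ⟩ := exists_addMonoidHom_ne_zero (k := k) hb0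
  obtain ⟨c, hc⟩ := exists_weighted_wronskian_eq_C ℓ hJ ha hb
  have hℓab : (e : k) * ℓ a = d * ℓ b := by
    simpa only [← nsmul_eq_mul, map_nsmul] using congrArg ℓ (by simpa using hab : e • a = d • b)
  have hd : C (d : k) = C (ℓ b)⁻¹ * C (e : k) * C (ℓ a) := by
    rw [← C_mul, ← C_mul, mul_assoc, hℓab]; congr 1; field_simp
  have he : C (e : k) = C (ℓ b)⁻¹ * C (e : k) * C (ℓ b) := by
    rw [← C_mul, ← C_mul]; congr 1; field_simp
  refine ⟨(ℓ b)⁻¹ * e * c, ?_⟩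
  rw [C_mul, C_mul, ← hc, hd, mul_sub]
  nth_rewrite 2 [he]
  ring

end Expansion

section Wronskian
variable {k : Type*} [Field k] [CharZero k] {f g p q : k[X]}

theorem C_leadingCoeff_mul_eq_of_wronskian_eq_zero (h : wronskian f g = 0) :
    C g.leadingCoeff * f = C f.leadingCoeff * g := by
  classical
  rcases eq_or_ne g 0 with rfl | hg0
  · simp
  obtain ⟨f', g', hf, hg, hunit⟩ := extract_gcd f g
  generalize gcd f g = D at hf hg
  have hD : D ≠ 0 := fun h0 => hg0 (by rw [hg, h0, zero_mul])
  have hcop : IsCoprime f' g' := (gcd_isUnit_iff f' g').mp hunit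
  have hw : D ^ 2 * wronskian f' g' = wronskian f g := by
    rw [hf, hg]
    simp only [wronskian, derivative_mul]
    ring
  obtain ⟨hf', hg'⟩ := hcop.wronskian_eq_zero_iff.mp (by simpa [h, hD] using hw)
  rw [hf, hg, eq_C_of_derivative_eq_zero hf', eq_C_of_derivative_eq_zero hg']
  simp only [leadingCoeff_mul, leadingCoeff_C, C_mul]
  ring

theorem C_leadingCoeff_pow_mul_pow_eq (hp : p ≠ 0) (hq : q ≠ 0) {d e : ℕ}
    (h : C (d : k) * (p * derivative q) = C (e : k) * (derivative p * q)) :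
    C (q.leadingCoeff ^ d) * p ^ e = C (p.leadingCoeff ^ e) * q ^ d := by
  rw [← leadingCoeff_pow, ← leadingCoeff_pow]
  apply C_leadingCoeff_mul_eq_of_wronskian_eq_zero
  have hpow (f : k[X]) (n : ℕ) : f * derivative (f ^ n) = C (n : k) * derivative f * f ^ n := by
    cases n with
    | zero => simp
    | succ n => rw [derivative_pow_succ]; push_cast; simp; ring
  have : p * q * wronskian (p ^ e) (q ^ d) = 0 := by
    have hpq := congrArg (p ^ e * q ^ d * ·) h
    simp only [wronskian]
    linear_combination p * p ^ e * hpow q d - q * q ^ d * hpow p e + hpq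
  simpa [hp, hq] using this

end Wronskian

section Sweep
open scoped Topology
open Filter
variable {k : Type*} [CommRing k] {F U V : (HahnSeries ℝ k)[X]} {r R : ℝ}

theorem rescale_ne_zero (hF : F ≠ 0) (r : ℝ) : rescale r F ≠ 0 :=
  (map_ne_zero_iff _ (rescale_injective r)).mpr hF

theorem order_rescale_eq_inf' (hF : F ≠ 0) (r : ℝ) :
    (rescale r F).order =
      F.support.inf' (support_nonempty.mpr hF) fun i => (F.coeff i).order + i * r := by
  refine le_antisymm
    (Finset.le_inf' _ _ fun i hi => order_rescale_le (mem_support_iff.mp hi) r) ?_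
  obtain ⟨i, hi⟩ := nonempty_support_iff.mpr (leadingCoeff_rescale_ne_zero hF r)
  rw [mem_support_iff, coeff_leadingCoeff_rescale] at hi
  refine Finset.inf'_le_of_le _
    (mem_support_iff.mpr fun h => hi (by rw [h, HahnSeries.coeff_zero])) ?_
  linarith [HahnSeries.order_le_of_coeff_ne_zero hi]

theorem continuous_order_rescale (F : (HahnSeries ℝ k)[X]) :
    Continuous fun r => (rescale r F).order := by
  rcases eq_or_ne F 0 with rfl | hF
  · simpa using continuous_const
  simp only [order_rescale_eq_inf' hF]
  fun_prop

theorem order_le_of_coeff_leadingCoeff_rescale_ne_zero {i : ℕ}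
    (hi : (rescale R F).leadingCoeff.coeff i ≠ 0) :
    (F.coeff i).order ≤ (rescale R F).order - i * R :=
  HahnSeries.order_le_of_coeff_ne_zero (coeff_leadingCoeff_rescale R F i ▸ hi)

theorem eventually_order_rescale_eq (hF : F ≠ 0) (R : ℝ) : ∀ᶠ r in 𝓝[<] R,
    (rescale r F).order =
      (rescale R F).order + (rescale R F).leadingCoeff.natDegree * (r - R) := by
  set n := (rescale R F).leadingCoeff.natDegree
  have hn : (F.coeff n).order ≤ (rescale R F).order - n * R :=
    order_le_of_coeff_leadingCoeff_rescale_ne_zero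
      (leadingCoeff_ne_zero.mpr (leadingCoeff_rescale_ne_zero hF R))
  have hFn : F.coeff n ≠ 0 := fun h => leadingCoeff_rescale_ne_zero hF R <|
    leadingCoeff_eq_zero.mp ((coeff_leadingCoeff_rescale R F n).trans (by simp [h]))
  have hlow : ∀ i ∈ F.support, ∀ᶠ r in 𝓝[<] R,
      (rescale R F).order + n * (r - R) ≤ (F.coeff i).order + i * r := by
    intro i hi
    have hle := order_rescale_le (mem_support_iff.mp hi) R
    rcases hle.lt_or_eq with hlt | heq
    · have hcont : ContinuousAt (fun r => (F.coeff i).order + i * r -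
          ((rescale R F).order + n * (r - R))) R := by fun_prop
      filter_upwards [nhdsWithin_le_nhds (hcont.eventually_const_lt (u := 0) (by linarith))]
        with r hr
      linarith
    · have hin : i ≤ n := by
        refine le_natDegree_of_ne_zero ?_
        rw [coeff_leadingCoeff_rescale, heq, add_sub_cancel_right, Ne,
          HahnSeries.coeff_order_eq_zero]
        exact mem_support_iff.mp hi
      filter_upwards [self_mem_nhdsWithin] with r hr
      have : (i : ℝ) ≤ n := by exact_mod_cast hin
      nlinarith [Set.mem_Iio.mp hr]
  filter_upwards [(Finset.eventually_all F.support).mpr hlow] with r hr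
  refine le_antisymm ?_ ?_
  · linarith [order_rescale_le hFn r]
  · rw [order_rescale_eq_inf' hF r]
    exact Finset.le_inf' _ _ hr

/-- `U` and `V` have the same reduction on the disc of radius `t ^ r`: their difference is smaller
there, for the Gauss order, than `U`. -/
def SameReduction (r : ℝ) (U V : (HahnSeries ℝ k)[X]) : Prop :=
  (rescale r U).orderTop < (rescale r (U - V)).orderTop

theorem SameReduction.order_eq (h : SameReduction r U V) :
    (rescale r U).order = (rescale r V).order := by
  have := HahnSeries.orderTop_sub h
  have hU : rescale r U ≠ 0 := HahnSeries.orderTop_ne_top.mp h.ne_top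
  rw [← map_sub, sub_sub_cancel] at this
  have hV : rescale r V ≠ 0 := HahnSeries.orderTop_ne_top.mp (this.trans_ne h.ne_top)
  rwa [← HahnSeries.order_eq_orderTop_of_ne_zero hU, ← HahnSeries.order_eq_orderTop_of_ne_zero hV,
    WithTop.coe_inj, eq_comm] at this

theorem SameReduction.leadingCoeff_eq (h : SameReduction r U V) :
    (rescale r U).leadingCoeff = (rescale r V).leadingCoeff := by
  have := HahnSeries.leadingCoeff_sub h
  rwa [← map_sub, sub_sub_cancel, eq_comm] at this

theorem sameReduction_of_leadingCoeff_eq (hU : U ≠ 0) (hV : V ≠ 0)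
    (ho : (rescale r U).order = (rescale r V).order)
    (hc : (rescale r U).leadingCoeff = (rescale r V).leadingCoeff) : SameReduction r U V := by
  have hUo := (HahnSeries.order_eq_orderTop_of_ne_zero (rescale_ne_zero hU r)).symm
  have hVo := (HahnSeries.order_eq_orderTop_of_ne_zero (rescale_ne_zero hV r)).symm
  rw [SameReduction, hUo, map_sub]
  exact HahnSeries.le_orderTop_of_leadingCoeff_eq hUo (ho ▸ hVo) hc

theorem sameReduction_self (hU : U ≠ 0) (r : ℝ) : SameReduction r U U :=
  sameReduction_of_leadingCoeff_eq hU hU rfl rfl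

theorem sameReduction_iff_order_lt (hU : U ≠ 0) (hUV : U ≠ V) :
    SameReduction r U V ↔ (rescale r U).order < (rescale r (U - V)).order := by
  rw [SameReduction, ← HahnSeries.order_eq_orderTop_of_ne_zero (rescale_ne_zero hU r),
    ← HahnSeries.order_eq_orderTop_of_ne_zero (rescale_ne_zero (sub_ne_zero.mpr hUV) r),
    WithTop.coe_lt_coe]

theorem isOpen_setOf_sameReduction (hU : U ≠ 0) (V : (HahnSeries ℝ k)[X]) :
    IsOpen {r | SameReduction r U V} := by
  rcases eq_or_ne U V with rfl | hUV
  · simp [sameReduction_self hU]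
  · simp only [sameReduction_iff_order_lt hU hUV]
    exact isOpen_lt (continuous_order_rescale U) (continuous_order_rescale _)

theorem eventually_atBot_sameReduction (hU : U ≠ 0) (hdeg : U.natDegree = V.natDegree)
    (hlead : U.leadingCoeff = V.leadingCoeff) : ∀ᶠ r in atBot, SameReduction r U V := by
  rcases eq_or_ne U V with rfl | hUV
  · exact .of_forall (sameReduction_self hU)
  simp only [sameReduction_iff_order_lt hU hUV, order_rescale_eq_inf' (sub_ne_zero.mpr hUV),
    Finset.lt_inf'_iff]
  refine (Finset.eventually_all _).mpr fun i hi => ?_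
  have hV : V ≠ 0 := leadingCoeff_ne_zero.mp (hlead ▸ leadingCoeff_ne_zero.mpr hU)
  have hdeg' : U.degree = V.degree := by
    rw [degree_eq_natDegree hU, degree_eq_natDegree hV, hdeg]
  have hin : i < U.natDegree := (le_natDegree_of_mem_supp i hi).trans_lt <|
    natDegree_lt_natDegree (sub_ne_zero.mpr hUV) (degree_sub_lt_left hdeg' hU hlead)
  filter_upwards [(tendsto_id.const_mul_atBot
    (sub_pos.mpr (Nat.cast_lt.mpr hin : (i : ℝ) < U.natDegree))).eventually_lt_atBot
    (((U - V).coeff i).order - U.leadingCoeff.order)] with r hr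
  have := order_rescale_le (leadingCoeff_ne_zero.mpr hU) r
  simp only [id_eq, coeff_natDegree] at hr this
  linarith

/-- The reductions of `U` and `V` on the disc of radius `t ^ r` have the same Gauss order and
the same top-degree term. -/
def TopAligned (r : ℝ) (U V : (HahnSeries ℝ k)[X]) : Prop :=
  (rescale r U).order = (rescale r V).order ∧
  (rescale r U).leadingCoeff.natDegree = (rescale r V).leadingCoeff.natDegree ∧
  (rescale r U).leadingCoeff.leadingCoeff = (rescale r V).leadingCoeff.leadingCoeff

theorem topAligned_of_eventually_sameReduction (hU : U ≠ 0) (hV : V ≠ 0)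
    (h : ∀ᶠ r in 𝓝[<] R, SameReduction r U V) : TopAligned R U V := by
  have horder : (rescale R U).order = (rescale R V).order :=
    tendsto_nhds_unique_of_eventuallyEq
      (continuous_order_rescale U).continuousWithinAt
      (continuous_order_rescale V).continuousWithinAt
      (h.mono fun r hr => hr.order_eq)
  obtain ⟨r, hr, hrU, hrV, hrR⟩ := (h.and ((eventually_order_rescale_eq hU R).and
    ((eventually_order_rescale_eq hV R).and self_mem_nhdsWithin))).exists
  have hdeg : (rescale R U).leadingCoeff.natDegree = (rescale R V).leadingCoeff.natDegree := by
    have : ((rescale R U).leadingCoeff.natDegree : ℝ) * (r - R) =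
      (rescale R V).leadingCoeff.natDegree * (r - R) := by linarith [hr.order_eq]
    exact_mod_cast mul_right_cancel₀ (sub_ne_zero.mpr (Set.mem_Iio.mp hrR).ne) this
  have hcoeff {F : (HahnSeries ℝ k)[X]} (hF : (rescale r F).order =
      (rescale R F).order + (rescale R F).leadingCoeff.natDegree * (r - R)) :
      (rescale R F).leadingCoeff.leadingCoeff =
        (rescale r F).leadingCoeff.coeff (rescale R F).leadingCoeff.natDegree := by
    rw [leadingCoeff, coeff_leadingCoeff_rescale, coeff_leadingCoeff_rescale, hF]
    congr 1
    ring
  exact ⟨horder, hdeg, by rw [hcoeff hrU, hcoeff hrV, hr.leadingCoeff_eq, hdeg]⟩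

theorem topAligned_of_forall_lt (hU : U ≠ 0) (hV : V ≠ 0) (hdeg : U.natDegree = V.natDegree)
    (hlead : U.leadingCoeff = V.leadingCoeff) {q : ℝ}
    (hstep : ∀ r < q, TopAligned r U V → SameReduction r U V) : TopAligned q U V := by
  suffices h : ∀ r < q, SameReduction r U V from
    topAligned_of_eventually_sameReduction hU hV (eventually_nhdsWithin_of_forall h)
  by_contra! hex
  set Z := {r | r < q ∧ ¬ SameReduction r U V}
  have hZ : Z.Nonempty := hex
  obtain ⟨a, ha⟩ := eventually_atBot.mp (eventually_atBot_sameReduction hU hdeg hlead)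
  have hbdd : BddBelow Z := ⟨a, fun r hr => le_of_not_ge fun hra => hr.2 (ha r hra)⟩
  obtain ⟨r₀, hr₀⟩ := hZ
  have hlt : sInf Z < q := (csInf_le hbdd hr₀).trans_lt hr₀.1
  have hnot : ¬ SameReduction (sInf Z) U V :=
    closure_minimal (fun _ hr => hr.2) (isOpen_setOf_sameReduction hU V).isClosed_compl
      (csInf_mem_closure hex hbdd)
  refine hnot (hstep _ hlt (topAligned_of_eventually_sameReduction hU hV ?_))
  refine eventually_nhdsWithin_of_forall fun r hr => ?_
  by_contra hrn
  exact notMem_of_lt_csInf hr hbdd ⟨(Set.mem_Iio.mp hr).trans hlt, hrn⟩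

end Sweep

section Alignment
variable {k : Type*} [Field k] {F G : (HahnSeries ℝ k)[X]} {d e : ℕ} {α β : k} {q r : ℝ}

theorem rescale_C_C_mul_pow (r : ℝ) (α : k) (F : (HahnSeries ℝ k)[X]) (n : ℕ) :
    rescale r (C (HahnSeries.C α) * F ^ n) = HahnSeries.C (C α) * rescale r F ^ n := by
  simp [HahnSeries.C_apply]

theorem leadingCoeff_rescale_C_C_mul_pow (r : ℝ) (α : k) (F : (HahnSeries ℝ k)[X]) (n : ℕ) :
    (rescale r (C (HahnSeries.C α) * F ^ n)).leadingCoeff =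
      C α * (rescale r F).leadingCoeff ^ n := by
  induction n with
  | zero => simp [HahnSeries.C_apply]
  | succ n ih =>
    rw [pow_succ, ← mul_assoc, map_mul, HahnSeries.leadingCoeff_mul, ih, pow_succ, mul_assoc]

theorem order_rescale_C_C_mul_pow (r : ℝ) (hα : α ≠ 0) (hF : F ≠ 0) (n : ℕ) :
    (rescale r (C (HahnSeries.C α) * F ^ n)).order = n * (rescale r F).order := by
  rw [rescale_C_C_mul_pow, HahnSeries.order_mul (by simpa using hα)
    (pow_ne_zero n (rescale_ne_zero hF r)), HahnSeries.order_C, HahnSeries.order_pow]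
  simp

theorem topAligned_C_C_mul_pow_iff (hα : α ≠ 0) (hβ : β ≠ 0) (hF : F ≠ 0) (hG : G ≠ 0) :
    TopAligned r (C (HahnSeries.C α) * F ^ e) (C (HahnSeries.C β) * G ^ d) ↔
      e * (rescale r F).order = d * (rescale r G).order ∧
      e * (rescale r F).leadingCoeff.natDegree = d * (rescale r G).leadingCoeff.natDegree ∧
      α * (rescale r F).leadingCoeff.leadingCoeff ^ e =
        β * (rescale r G).leadingCoeff.leadingCoeff ^ d := by
  rw [TopAligned, order_rescale_C_C_mul_pow r hα hF, order_rescale_C_C_mul_pow r hβ hG]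
  simp only [leadingCoeff_rescale_C_C_mul_pow, natDegree_C_mul hα, natDegree_C_mul hβ,
    natDegree_pow, leadingCoeff_mul, leadingCoeff_C, leadingCoeff_pow]

theorem natDegree_coeff_zero_rescale_eq_zero (hrq : r < q) (h : 0 ≤ (rescale r F).orderTop) :
    ((rescale q F).coeff 0).natDegree = 0 := by
  refine natDegree_eq_zero_iff_degree_le_zero.mpr <|
    (degree_le_iff_coeff_zero _ _).mpr fun i hi => ?_
  have hi' : (0 : ℝ) < i := by exact_mod_cast hi
  rw [coeff_coeff_rescale]
  refine HahnSeries.coeff_eq_zero_of_lt_orderTop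
    (lt_of_lt_of_le ?_ ((le_orderTop_rescale_iff (w := 0)).mp h i))
  rw [WithTop.coe_lt_coe]
  nlinarith

theorem coeff_zero_leadingCoeff_rescale_eq_zero (hq : 0 ≤ (rescale q F).orderTop)
    (hr : (rescale r F).order < 0) : (rescale r F).leadingCoeff.coeff 0 = 0 := by
  rw [coeff_leadingCoeff_rescale]
  refine HahnSeries.coeff_eq_zero_of_lt_orderTop
    (lt_of_lt_of_le ?_ ((le_orderTop_rescale_iff (w := 0)).mp hq 0))
  simpa using hr

variable [CharZero k]

theorem sameReduction_of_topAligned_of_wronskian (hα : α ≠ 0) (hβ : β ≠ 0) (hF : F ≠ 0)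
    (hG : G ≠ 0)
    (hW : C (d : k) * ((rescale r F).leadingCoeff * derivative (rescale r G).leadingCoeff) =
      C (e : k) * (derivative (rescale r F).leadingCoeff * (rescale r G).leadingCoeff))
    (h : TopAligned r (C (HahnSeries.C α) * F ^ e) (C (HahnSeries.C β) * G ^ d)) :
    SameReduction r (C (HahnSeries.C α) * F ^ e) (C (HahnSeries.C β) * G ^ d) := by
  have hne {α : k} (hα : α ≠ 0) {F : (HahnSeries ℝ k)[X]} (hF : F ≠ 0) (n : ℕ) :
      C (HahnSeries.C α) * F ^ n ≠ 0 :=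
    mul_ne_zero (by simpa using hα) (pow_ne_zero n hF)
  refine sameReduction_of_leadingCoeff_eq (hne hα hF e) (hne hβ hG d) h.1 ?_
  have hp := leadingCoeff_rescale_ne_zero hF r
  have hq := leadingCoeff_rescale_ne_zero hG r
  obtain ⟨-, -, hlead⟩ := (topAligned_C_C_mul_pow_iff hα hβ hF hG).mp h
  have hpow := C_leadingCoeff_pow_mul_pow_eq hp hq hW
  rw [leadingCoeff_rescale_C_C_mul_pow, leadingCoeff_rescale_C_C_mul_pow]
  refine mul_left_cancel₀
    (C_ne_zero.mpr (pow_ne_zero d (leadingCoeff_ne_zero.mpr hq))) ?_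
  have hlead' := congrArg (C · * (rescale r G).leadingCoeff ^ d) hlead
  simp only [C_mul] at hlead'
  linear_combination C α * hpow + hlead'

theorem topAligned_expandAt {φ : HahnSeries ℝ k} {P Q : MvPolynomial (Fin 2) k}
    (hJ : ∃ c, jacobian P Q = MvPolynomial.C c)
    (hd : d ≠ 0) (he : e ≠ 0) (hα : α ≠ 0) (hβ : β ≠ 0)
    (hP0 : expandAt φ P ≠ 0) (hQ0 : expandAt φ Q ≠ 0)
    (hdeg : e * (expandAt φ P).natDegree = d * (expandAt φ Q).natDegree)
    (hlead : HahnSeries.C α * (expandAt φ P).leadingCoeff ^ e =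
      HahnSeries.C β * (expandAt φ Q).leadingCoeff ^ d)
    (hP : 0 ≤ (rescale q (expandAt φ P)).orderTop) (hQ : 0 ≤ (rescale q (expandAt φ Q)).orderTop)
    (hne : ((rescale q (expandAt φ P)).coeff 0).natDegree ≠ 0 ∨
      ((rescale q (expandAt φ Q)).coeff 0).natDegree ≠ 0) :
    TopAligned q (C (HahnSeries.C α) * expandAt φ P ^ e)
      (C (HahnSeries.C β) * expandAt φ Q ^ d) := by
  have hCα : HahnSeries.C (Γ := ℝ) α ≠ 0 := by simpa using hα
  have hCβ : HahnSeries.C (Γ := ℝ) β ≠ 0 := by simpa using hβ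
  refine topAligned_of_forall_lt (mul_ne_zero (C_ne_zero.mpr hCα) (pow_ne_zero e hP0))
    (mul_ne_zero (C_ne_zero.mpr hCβ) (pow_ne_zero d hQ0))
    (by simpa only [natDegree_C_mul hCα, natDegree_C_mul hCβ, natDegree_pow] using hdeg)
    (by simpa only [leadingCoeff_mul, leadingCoeff_C, leadingCoeff_pow] using hlead)
    fun r hrq halign => sameReduction_of_topAligned_of_wronskian hα hβ hP0 hQ0 ?_ halign
  obtain ⟨horder, -, -⟩ := (topAligned_C_C_mul_pow_iff hα hβ hP0 hQ0).mp halign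
  have hd' : (0 : ℝ) < d := by positivity
  have he' : (0 : ℝ) < e := by positivity
  have hbneg : (rescale r (expandAt φ Q)).order < 0 := by
    by_contra! hb
    have ha : 0 ≤ (rescale r (expandAt φ P)).order := by nlinarith
    have hconst {F : (HahnSeries ℝ k)[X]} (h : 0 ≤ (rescale r F).order) :=
      natDegree_coeff_zero_rescale_eq_zero (F := F) hrq
        ((WithTop.coe_le_coe.mpr h).trans (order_le_orderTop _))
    exact hne.elim (· (hconst ha)) (· (hconst hb))
  have haneg : (rescale r (expandAt φ P)).order < 0 := by nlinarith
  obtain ⟨c, hc⟩ := exists_wronskian_leadingCoeff_eq_C hJ (order_le_orderTop _)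
    (order_le_orderTop _) horder hbneg.ne
  rw [← HahnSeries.leadingCoeff_eq, ← HahnSeries.leadingCoeff_eq] at hc
  have hc0 := congrArg (coeff · 0) hc
  simp only [coeff_sub, mul_coeff_zero,
    coeff_zero_leadingCoeff_rescale_eq_zero hP haneg,
    coeff_zero_leadingCoeff_rescale_eq_zero hQ hbneg, coeff_C_zero, zero_mul, mul_zero,
    sub_zero] at hc0
  rwa [← hc0, C_0, sub_eq_zero] at hc

end Alignment

section BranchValue
variable {Γ k κ : Type*} [Field Γ] [LinearOrder Γ] [IsStrictOrderedRing Γ]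

theorem exists_mapCoeff_eq [CommRing k] [CommRing κ] {f : k →+* κ} {y : HahnSeries Γ κ}
    (hy : ∀ s, y.coeff s ∈ f.range) : ∃ φ, mapCoeff f φ = y := by
  classical
  choose c hc using hy
  refine ⟨⟨fun s => if y.coeff s = 0 then 0 else c s, y.isPWO_support.mono fun s hs h0 => ?_⟩, ?_⟩
  · exact hs (if_pos h0)
  · ext s
    rw [coeff_mapCoeff]
    dsimp only
    split_ifs with h
    · rw [map_zero, h]
    · exact hc s

theorem exists_notMem_range_coeff_sub_mapCoeff [CommRing k] [CommRing κ] {f : k →+* κ}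
    {y : HahnSeries Γ κ} (hy : ∃ s, y.coeff s ∉ f.range) :
    ∃ φ, ∃ r : Γ, (r : WithTop Γ) ≤ (y - mapCoeff f φ).orderTop ∧
      (y - mapCoeff f φ).coeff r ∉ f.range := by
  have hwf : {s | y.coeff s ∉ f.range}.IsWF :=
    y.isWF_support.mono fun s hs h0 => hs (by rw [h0]; exact zero_mem _)
  obtain ⟨φ, hφ⟩ := exists_mapCoeff_eq (f := f) (y := HahnSeries.truncLT (hwf.min hy) y) fun s => by
    rw [HahnSeries.coeff_truncLT]
    split_ifs with hs
    · exact of_not_not fun h => hwf.not_lt_min hy h hs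
    · exact zero_mem _
  refine ⟨φ, hwf.min hy, HahnSeries.le_orderTop_iff_forall.mpr fun s hs => ?_, ?_⟩
  · rw [hφ, HahnSeries.coeff_sub, HahnSeries.coeff_truncLT_of_lt (WithTop.coe_lt_coe.mp hs),
      sub_self]
  · rw [hφ, HahnSeries.coeff_sub, HahnSeries.coeff_truncLT_of_le le_rfl, sub_zero]
    exact hwf.min_mem hy

section Specialization
variable [Field k] [Field κ] [Algebra k κ] {F : (HahnSeries Γ k)[X]} {δ : HahnSeries Γ κ} {r w : Γ}

theorem coeff_eval_map_mapCoeff (hF : w ≤ (rescale r F).orderTop) (hδ : r ≤ δ.orderTop) :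
    ((F.map (mapCoeff (algebraMap k κ))).eval δ).coeff w =
      ((rescale r F).coeff w).aeval (δ.coeff r) := by
  have hF' : w ≤ (rescale r (F.map (mapCoeff (algebraMap k κ)))).orderTop := by
    rw [rescale_map]
    exact hF.trans (le_orderTop_mapCoeff _ _)
  rw [coeff_eval_of_le_orderTop hF' hδ, rescale_map, coeff_mapCoeff, coe_mapRingHom,
    eval_map_algebraMap]

theorem aeval_ne_zero_of_notMem_range [IsAlgClosed k] {ξ : κ} (hξ : ξ ∉ (algebraMap k κ).range)
    {p : k[X]} (hp : p ≠ 0) : p.aeval ξ ≠ 0 := by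
  intro h
  have hint : IsIntegral k ξ := (show IsAlgebraic k ξ from ⟨p, hp, h⟩).isIntegral
  exact hξ (minpoly.mem_range_of_degree_eq_one k ξ
    (IsAlgClosed.degree_eq_one_of_irreducible k (minpoly.irreducible hint)))

theorem orderTop_eval_map_le [IsAlgClosed k] (hδ : r ≤ δ.orderTop)
    (hξ : δ.coeff r ∉ (algebraMap k κ).range) :
    ((F.map (mapCoeff (algebraMap k κ))).eval δ).orderTop ≤ (rescale r F).orderTop := by
  rcases eq_or_ne F 0 with rfl | hF
  · simp
  rw [← HahnSeries.order_eq_orderTop_of_ne_zero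
    ((map_ne_zero_iff _ (rescale_injective r)).mpr hF)]
  refine HahnSeries.orderTop_le_of_coeff_ne_zero ?_
  rw [coeff_eval_map_mapCoeff (order_le_orderTop _) hδ, ← HahnSeries.leadingCoeff_eq]
  exact aeval_ne_zero_of_notMem_range hξ (leadingCoeff_rescale_ne_zero hF r)

end Specialization

/-- The restriction of a bivariate polynomial to the branch at infinity `x = t⁻¹`, `y = y(t)`. -/
noncomputable def evalBranch [CommRing k] [CommRing κ] [Algebra k κ] (y : HahnSeries Γ κ) :
    MvPolynomial (Fin 2) k →+* HahnSeries Γ κ :=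
  MvPolynomial.eval₂Hom (HahnSeries.C.comp (algebraMap k κ)) ![HahnSeries.single (-1) 1, y]

theorem evalBranch_add_mapCoeff [CommRing k] [CommRing κ] [Algebra k κ] (φ : HahnSeries Γ k)
    (δ : HahnSeries Γ κ) (P : MvPolynomial (Fin 2) k) :
    evalBranch (δ + mapCoeff (algebraMap k κ) φ) P =
      ((expandAt φ P).map (mapCoeff (algebraMap k κ))).eval δ := by
  rw [← coe_mapRingHom, ← coe_evalRingHom, expandAt, MvPolynomial.coe_eval₂Hom,
    MvPolynomial.hom_eval₂, MvPolynomial.hom_eval₂, evalBranch, MvPolynomial.coe_eval₂Hom]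
  congr 1
  · ext c : 1; simp [HahnSeries.C_apply]
  · ext i : 1; fin_cases i <;> simp

theorem evalBranch_mapCoeff [CommRing k] [CommRing κ] [Algebra k κ] (φ : HahnSeries Γ k)
    (P : MvPolynomial (Fin 2) k) : evalBranch (mapCoeff (algebraMap k κ) φ) P =
      mapCoeff (algebraMap k κ) ((expandAt φ P).eval 0) := by
  rw [← zero_add (mapCoeff _ φ), evalBranch_add_mapCoeff, eval_map, eval₂_at_zero,
    coeff_zero_eq_eval_zero]

/-- A bivariate polynomial over `k` as a polynomial in its second variable, with coefficients
polynomials over a `k`-algebra `S` in the first variable. -/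
noncomputable def polyInY [CommRing k] (S : Type*) [CommRing S] [Algebra k S] :
    MvPolynomial (Fin 2) k →ₐ[k] S[X][X] :=
  MvPolynomial.aeval ![C X, X]

/-- The substitution `x = t⁻¹` in a univariate polynomial. -/
noncomputable def evalInvT [CommRing k] : k[X] →+* HahnSeries Γ k :=
  eval₂RingHom HahnSeries.C (HahnSeries.single (-1) 1)

theorem expandAt_eq_taylor [CommRing k] (φ : HahnSeries Γ k) (P : MvPolynomial (Fin 2) k) :
    expandAt φ P = taylor φ ((polyInY k P).map evalInvT) := by
  rw [polyInY, MvPolynomial.aeval_def, ← coe_mapRingHom, MvPolynomial.hom_eval₂,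
    ← taylorAlgHom_apply, ← AlgHom.coe_toRingHom, MvPolynomial.hom_eval₂, expandAt,
    MvPolynomial.coe_eval₂Hom]
  congr 1
  · ext c : 1; simp [evalInvT, HahnSeries.C_apply]
  · ext i : 1; fin_cases i <;> simp [evalInvT]

theorem evalBranch_eq_eval [CommRing k] [CommRing κ] [Algebra k κ] (y : HahnSeries Γ κ)
    (P : MvPolynomial (Fin 2) k) :
    evalBranch y P = ((polyInY κ P).map evalInvT).eval y := by
  rw [polyInY, MvPolynomial.aeval_def, ← coe_mapRingHom, MvPolynomial.hom_eval₂,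
    ← coe_evalRingHom, MvPolynomial.hom_eval₂, evalBranch, MvPolynomial.coe_eval₂Hom]
  congr 1
  · ext c : 1; simp [evalInvT, HahnSeries.C_apply]
  · ext i : 1; fin_cases i <;> simp [evalInvT]

theorem natDegree_expandAt [CommRing k] {φ : HahnSeries Γ k} {P : MvPolynomial (Fin 2) k} {A : k}
    (hA : A ≠ 0) (hP : (polyInY k P).leadingCoeff = C A) :
    (expandAt φ P).natDegree = (polyInY k P).natDegree := by
  rw [expandAt_eq_taylor, natDegree_taylor, natDegree_map_of_leadingCoeff_ne_zero]
  simpa [hP, evalInvT] using hA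

theorem leadingCoeff_expandAt [CommRing k] {φ : HahnSeries Γ k} {P : MvPolynomial (Fin 2) k}
    {A : k} (hA : A ≠ 0) (hP : (polyInY k P).leadingCoeff = C A) :
    (expandAt φ P).leadingCoeff = HahnSeries.C A := by
  have : evalInvT (Γ := Γ) (polyInY k P).leadingCoeff = HahnSeries.C A := by simp [hP, evalInvT]
  rw [expandAt_eq_taylor, leadingCoeff_taylor, leadingCoeff_map_of_leadingCoeff_ne_zero, this]
  simpa [this] using hA

end BranchValue

section PolynomialCurve
variable {k κ : Type*} [Field k] [CharZero k] [Field κ] [Algebra k κ]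
  {P Q : MvPolynomial (Fin 2) k} {K d e : ℕ} {A B : k}

theorem exists_aligned_leadingCoeff (hJ : ∃ c, jacobian P Q = MvPolynomial.C c)
    (hd : d ≠ 0) (he : e ≠ 0) (hA : A ≠ 0) (hB : B ≠ 0)
    (hPy : (polyInY k P).natDegree = K * d) (hPA : (polyInY k P).leadingCoeff = C A)
    (hQy : (polyInY k Q).natDegree = K * e) (hQB : (polyInY k Q).leadingCoeff = C B)
    {φ : HahnSeries ℝ k} {r : ℝ} (hP : 0 ≤ (rescale r (expandAt φ P)).orderTop)
    (hQ : 0 ≤ (rescale r (expandAt φ Q)).orderTop)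
    (hne : ((rescale r (expandAt φ P)).coeff 0).natDegree ≠ 0 ∨
      ((rescale r (expandAt φ Q)).coeff 0).natDegree ≠ 0) :
    e * ((rescale r (expandAt φ P)).coeff 0).natDegree =
        d * ((rescale r (expandAt φ Q)).coeff 0).natDegree ∧
      B ^ d * ((rescale r (expandAt φ P)).coeff 0).leadingCoeff ^ e =
        A ^ e * ((rescale r (expandAt φ Q)).coeff 0).leadingCoeff ^ d := by
  have hPl := leadingCoeff_expandAt (φ := φ) hA hPA
  have hQl := leadingCoeff_expandAt (φ := φ) hB hQB
  have hP0 : expandAt φ P ≠ 0 := leadingCoeff_ne_zero.mp (by simpa [hPl] using hA)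
  have hQ0 : expandAt φ Q ≠ 0 := leadingCoeff_ne_zero.mp (by simpa [hQl] using hB)
  have hα := pow_ne_zero d hB
  have hβ := pow_ne_zero e hA
  obtain ⟨horder, hdeg, hlead⟩ := (topAligned_C_C_mul_pow_iff hα hβ hP0 hQ0).mp <|
    topAligned_expandAt hJ hd he hα hβ hP0 hQ0
      (by rw [natDegree_expandAt hA hPA, natDegree_expandAt hB hQB, hPy, hQy]; ring)
      (by rw [hPl, hQl, map_pow, map_pow]; ring) hP hQ hne
  have hd' : (0 : ℝ) < d := by positivity
  have he' : (0 : ℝ) < e := by positivity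
  have hPo := le_order_of_le_orderTop hP (rescale_ne_zero hP0 r)
  have hQo := le_order_of_le_orderTop hQ (rescale_ne_zero hQ0 r)
  have hzero {F : (HahnSeries ℝ k)[X]} (h : ((rescale r F).coeff 0).natDegree ≠ 0) :
      (rescale r F).order ≤ 0 :=
    HahnSeries.order_le_of_coeff_ne_zero fun h0 => h (by rw [h0, natDegree_zero])
  have hPo0 : (rescale r (expandAt φ P)).order = 0 := by
    rcases hne with h | h
    · exact (hzero h).antisymm hPo
    · nlinarith [hzero h]
  have hQo0 : (rescale r (expandAt φ Q)).order = 0 := by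
    simpa [hPo0, hd] using horder.symm
  rw [HahnSeries.leadingCoeff_eq, HahnSeries.leadingCoeff_eq, hPo0, hQo0] at hdeg hlead
  exact ⟨hdeg, hlead⟩

theorem exists_polynomial_curve [IsAlgClosed k] (hJ : ∃ c, jacobian P Q = MvPolynomial.C c)
    (hd : d ≠ 0) (he : e ≠ 0) (hde : d.Coprime e) (hA : A ≠ 0) (hB : B ≠ 0)
    (hPy : (polyInY k P).natDegree = K * d) (hPA : (polyInY k P).leadingCoeff = C A)
    (hQy : (polyInY k Q).natDegree = K * e) (hQB : (polyInY k Q).leadingCoeff = C B)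
    {y : HahnSeries ℝ κ} (hP : 0 ≤ (evalBranch y P).orderTop)
    (hQ : 0 ≤ (evalBranch y Q).orderTop)
    (hne : (evalBranch y P).coeff 0 ∉ (algebraMap k κ).range ∨
      (evalBranch y Q).coeff 0 ∉ (algebraMap k κ).range) :
    ∃ (ξ : κ) (p q : k[X]) (j : ℕ), j ≠ 0 ∧ p.natDegree = d * j ∧ q.natDegree = e * j ∧
      B ^ d * p.leadingCoeff ^ e = A ^ e * q.leadingCoeff ^ d ∧
      p.aeval ξ = (evalBranch y P).coeff 0 ∧ q.aeval ξ = (evalBranch y Q).coeff 0 := by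
  have hy : ∃ s, y.coeff s ∉ (algebraMap k κ).range := by
    by_contra! hy
    obtain ⟨φ, rfl⟩ := exists_mapCoeff_eq hy
    simp [evalBranch_mapCoeff] at hne
  obtain ⟨φ, r, hr, hξ⟩ := exists_notMem_range_coeff_sub_mapCoeff hy
  have heval (P : MvPolynomial (Fin 2) k) :=
    evalBranch_add_mapCoeff φ (y - mapCoeff (algebraMap k κ) φ) P
  simp only [sub_add_cancel] at heval
  have hP' := hP.trans (heval P ▸ orderTop_eval_map_le hr hξ)
  have hQ' := hQ.trans (heval Q ▸ orderTop_eval_map_le hr hξ)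
  have hPξ := coeff_eval_map_mapCoeff hP' hr
  have hQξ := coeff_eval_map_mapCoeff hQ' hr
  rw [← heval] at hPξ hQξ
  have hconst {p : k[X]} {u ξ : κ} (hu : u = p.aeval ξ) (hur : u ∉ (algebraMap k κ).range) :
      p.natDegree ≠ 0 := fun h => hur <| by
    rw [hu, eq_C_of_natDegree_eq_zero h, aeval_C]
    exact ⟨_, rfl⟩
  have hne' := hne.imp (hconst hPξ) (hconst hQξ)
  obtain ⟨hdeg, hlead⟩ :=
    exists_aligned_leadingCoeff hJ hd he hA hB hPy hPA hQy hQB hP' hQ' hne'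
  obtain ⟨j, hj⟩ : d ∣ ((rescale r (expandAt φ P)).coeff 0).natDegree :=
    hde.dvd_of_dvd_mul_left ⟨_, hdeg⟩
  have hj' : ((rescale r (expandAt φ Q)).coeff 0).natDegree = e * j := by
    rw [hj, mul_left_comm] at hdeg
    exact (Nat.eq_of_mul_eq_mul_left (Nat.pos_of_ne_zero hd) hdeg).symm
  refine ⟨_, _, _, j, ?_, hj, hj', hlead, hPξ.symm, hQξ.symm⟩
  rintro rfl
  exact hne'.elim (· hj) (· hj')

end PolynomialCurve

section Branch
variable {Γ k κ : Type*} [Field Γ] [LinearOrder Γ] [IsStrictOrderedRing Γ] [Field k] [Field κ]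

theorem orderTop_multiset_prod_map_le {R ι : Type*} [CommRing R] [IsDomain R]
    {g h : ι → HahnSeries Γ R} {s : Multiset ι} (H : ∀ i ∈ s, (g i).orderTop ≤ (h i).orderTop) :
    (s.map g).prod.orderTop ≤ (s.map h).prod.orderTop := by
  induction s using Multiset.induction_on with
  | empty => simp
  | cons i s ih =>
    simp only [Multiset.map_cons, Multiset.prod_cons, HahnSeries.orderTop_mul]
    exact add_le_add (H i (Multiset.mem_cons_self i s))
      (ih fun j hj => H j (Multiset.mem_cons_of_mem hj))

theorem orderTop_sub_C_pos_of_lt {z : HahnSeries Γ κ} {v v₀ : κ}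
    (h : (z - HahnSeries.C v₀).orderTop < (z - HahnSeries.C v).orderTop) :
    0 < (z - HahnSeries.C v).orderTop := by
  by_contra! hle
  have hadd := HahnSeries.min_orderTop_le_orderTop_add (x := z - HahnSeries.C v)
    (y := HahnSeries.C (v - v₀))
  have hC : 0 ≤ (HahnSeries.C (v - v₀) : HahnSeries Γ κ).orderTop := HahnSeries.orderTop_single_le
  rw [min_eq_left (hle.trans hC), map_sub, sub_add_sub_cancel] at hadd
  exact hadd.not_gt h

theorem orderTop_nonneg_of_orderTop_sub_C_pos {z : HahnSeries Γ κ} {v : κ}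
    (h : 0 < (z - HahnSeries.C v).orderTop) : 0 ≤ z.orderTop := by
  have hadd := HahnSeries.min_orderTop_le_orderTop_add (x := z - HahnSeries.C v)
    (y := HahnSeries.C v)
  rw [sub_add_cancel] at hadd
  exact (le_min h.le HahnSeries.orderTop_single_le).trans hadd

theorem coeff_zero_eq_of_orderTop_sub_C_pos {z : HahnSeries Γ κ} {v : κ}
    (h : 0 < (z - HahnSeries.C v).orderTop) : z.coeff 0 = v := by
  have := HahnSeries.coeff_eq_zero_of_lt_orderTop h
  rwa [HahnSeries.coeff_sub, HahnSeries.C_apply, HahnSeries.coeff_single_same, sub_eq_zero] at this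

theorem exists_root_of_orderTop_resultant_lt [IsAlgClosed κ] {F G : (HahnSeries Γ κ)[X]}
    {v v₀ : κ} (h : (resultant F (G - C (HahnSeries.C v₀))).orderTop <
      (resultant F (G - C (HahnSeries.C v))).orderTop) :
    ∃ y, F.eval y = 0 ∧ 0 < (G.eval y - HahnSeries.C v).orderTop := by
  have := isAlgClosed_hahnSeries (Γ := Γ) (k := κ)
  have hres (v : κ) : resultant F (G - C (HahnSeries.C v)) =
      F.leadingCoeff ^ G.natDegree * (F.roots.map fun y => G.eval y - HahnSeries.C v).prod := by
    rw [natDegree_sub_C, resultant_eq_prod_eval _ _ _ natDegree_sub_C.le (IsAlgClosed.splits F)]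
    simp only [eval_sub, eval_C]
  obtain ⟨y, hy, hlt⟩ : ∃ y ∈ F.roots,
      (G.eval y - HahnSeries.C v₀).orderTop < (G.eval y - HahnSeries.C v).orderTop := by
    by_contra! hle
    rw [hres, hres, HahnSeries.orderTop_mul, HahnSeries.orderTop_mul] at h
    exact h.not_ge (add_le_add le_rfl (orderTop_multiset_prod_map_le hle))
  exact ⟨y, isRoot_of_mem_roots hy, orderTop_sub_C_pos_of_lt hlt⟩

theorem orderTop_resultant_comm {R : Type*} [CommRing R] (F G : (HahnSeries Γ R)[X]) :
    (resultant F G).orderTop = (resultant G F).orderTop := by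
  rw [resultant_comm]
  rcases neg_one_pow_eq_or (HahnSeries Γ R) (F.natDegree * G.natDegree) with h | h <;>
    simp [h, HahnSeries.orderTop_neg]

theorem coeff_evalInvT (S : κ[X]) (s : Γ) :
    (evalInvT S).coeff s = S.sum fun i a => if s = -i then a else 0 := by
  rw [evalInvT, coe_eval₂RingHom, eval₂_eq_sum, sum_def, sum_def, HahnSeries.coeff_sum]
  refine Finset.sum_congr rfl fun i _ => ?_
  rw [HahnSeries.single_pow, HahnSeries.C_apply, HahnSeries.single_mul_single,
    HahnSeries.coeff_single]
  simp

theorem orderTop_evalInvT {S : κ[X]} (hS : S ≠ 0) :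
    (evalInvT S).orderTop = ((-S.natDegree : Γ) : WithTop Γ) := by
  refine le_antisymm (HahnSeries.orderTop_le_of_coeff_ne_zero ?_)
    (HahnSeries.le_orderTop_iff_forall.mpr fun s hs => ?_)
  · rw [coeff_evalInvT, sum_def, Finset.sum_eq_single_of_mem _ (natDegree_mem_support_of_nonzero hS)
      fun i _ hi => if_neg fun h => hi (Nat.cast_injective (neg_injective h)).symm, if_pos rfl]
    exact leadingCoeff_ne_zero.mpr hS
  · rw [coeff_evalInvT, sum_def]
    refine Finset.sum_eq_zero fun i hi => if_neg ?_
    rintro rfl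
    have : (i : Γ) ≤ S.natDegree := Nat.cast_le.mpr (le_natDegree_of_mem_supp i hi)
    exact (neg_le_neg this).not_gt (WithTop.coe_lt_coe.mp hs)

theorem orderTop_evalInvT_lt {S T : κ[X]} (h : T.degree < S.degree) :
    (evalInvT S).orderTop < (evalInvT (Γ := Γ) T).orderTop := by
  have hS : S ≠ 0 := degree_ne_bot.mp (bot_le.trans_lt h).ne'
  rw [orderTop_evalInvT hS]
  rcases eq_or_ne T 0 with rfl | hT
  · exact (WithTop.coe_lt_top _).trans_eq (by simp)
  · rw [orderTop_evalInvT hT, WithTop.coe_lt_coe, neg_lt_neg_iff, Nat.cast_lt]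
    exact natDegree_lt_natDegree hT h

theorem map_polyInY {S T : Type*} [CommRing S] [Algebra k S] [CommRing T] [Algebra k T]
    (g : S →ₐ[k] T) (P : MvPolynomial (Fin 2) k) :
    (polyInY S P).map (mapRingHom (g : S →+* T)) = polyInY T P := by
  rw [polyInY, polyInY, MvPolynomial.aeval_def, ← coe_mapRingHom, MvPolynomial.hom_eval₂,
    MvPolynomial.aeval_def]
  congr 1
  · ext c : 1; simp
  · ext i : 1; fin_cases i <;> simp

theorem natDegree_leadingCoeff_polyInY {S : Type*} [CommRing S] [Nontrivial S] [Algebra k S]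
    {P : MvPolynomial (Fin 2) k} {A : k} (hA : A ≠ 0) (hP : (polyInY k P).leadingCoeff = C A) :
    (polyInY S P).natDegree = (polyInY k P).natDegree ∧
      (polyInY S P).leadingCoeff = C (algebraMap k S A) := by
  have hA' : mapRingHom (algebraMap k S) (polyInY k P).leadingCoeff = C (algebraMap k S A) := by
    rw [hP, coe_mapRingHom, map_C]
  have hne : mapRingHom (algebraMap k S) (polyInY k P).leadingCoeff ≠ 0 := by
    rwa [hA', Ne, C_eq_zero, map_eq_zero]
  rw [← map_polyInY (Algebra.ofId k S) P]
  exact ⟨natDegree_map_of_leadingCoeff_ne_zero _ hne,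
    (leadingCoeff_map_of_leadingCoeff_ne_zero _ hne).trans hA'⟩

/-- The resultant in `y` of `P - u` and `Q - v`, a polynomial in `x` with coefficients in
`k[u, v]`. -/
noncomputable def fiberResultant (P Q : MvPolynomial (Fin 2) k) : (MvPolynomial (Fin 2) k)[X] :=
  resultant (polyInY (MvPolynomial (Fin 2) k) P - C (C (MvPolynomial.X 0)))
    (polyInY (MvPolynomial (Fin 2) k) Q - C (C (MvPolynomial.X 1)))

variable [Algebra k κ]

theorem evalInvT_map_fiberResultant {P Q : MvPolynomial (Fin 2) k} {A B : k} (hA : A ≠ 0)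
    (hB : B ≠ 0) (hPA : (polyInY k P).leadingCoeff = C A) (hQB : (polyInY k Q).leadingCoeff = C B)
    (u v : κ) :
    evalInvT (Γ := Γ) ((fiberResultant P Q).map (MvPolynomial.aeval ![u, v] : _ →ₐ[k] κ)) =
      resultant ((polyInY κ P).map evalInvT - C (HahnSeries.C u))
        ((polyInY κ Q).map evalInvT - C (HahnSeries.C v)) := by
  have hmap (P : MvPolynomial (Fin 2) k) (i : Fin 2) :
      ((polyInY (MvPolynomial (Fin 2) k) P - C (C (MvPolynomial.X i))).map
        (mapRingHom (MvPolynomial.aeval ![u, v] : _ →ₐ[k] κ))).map (evalInvT (Γ := Γ)) =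
      (polyInY κ P).map evalInvT - C (HahnSeries.C (![u, v] i)) := by
    rw [Polynomial.map_sub, map_polyInY, Polynomial.map_sub]
    simp [evalInvT]
  have hdeg {P : MvPolynomial (Fin 2) k} {A : k} (hA : A ≠ 0)
      (hP : (polyInY k P).leadingCoeff = C A) : ((polyInY κ P).map (evalInvT (Γ := Γ))).natDegree =
        (polyInY (MvPolynomial (Fin 2) k) P).natDegree := by
    obtain ⟨hκ, hκA⟩ := natDegree_leadingCoeff_polyInY (S := κ) hA hP
    rw [natDegree_map_of_leadingCoeff_ne_zero, hκ,
      (natDegree_leadingCoeff_polyInY (S := MvPolynomial (Fin 2) k) hA hP).1]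
    simpa [hκA, evalInvT] using hA
  rw [fiberResultant, ← coe_mapRingHom, ← resultant_map_map, ← resultant_map_map, hmap, hmap,
    natDegree_sub_C, natDegree_sub_C, natDegree_sub_C, natDegree_sub_C, hdeg hA hPA, hdeg hB hQB]
  rfl

theorem aeval_aeval_update_C {σ L : Type*} [DecidableEq σ] [CommRing L] [Algebra k L]
    (S : MvPolynomial σ k) (a : σ → k) (i : σ) (x : L) :
    (MvPolynomial.aeval (Function.update (C ∘ a) i X) S : k[X]).aeval x =
      MvPolynomial.aeval (Function.update (algebraMap k L ∘ a) i x) S := by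
  rw [← AlgHom.comp_apply, MvPolynomial.comp_aeval]
  congr 2
  ext j
  rcases eq_or_ne j i with rfl | hj <;> simp [*]

theorem exists_aeval_update_ne_zero [IsAlgClosed k] {σ : Type*} [DecidableEq σ]
    {S : MvPolynomial σ k} (hS : S ≠ 0) (i : σ) {ξ : κ} (hξ : ξ ∉ (algebraMap k κ).range) :
    ∃ a : σ → k, MvPolynomial.aeval (Function.update (algebraMap k κ ∘ a) i ξ) S ≠ 0 := by
  obtain ⟨a, ha⟩ : ∃ a, MvPolynomial.eval a S ≠ 0 := by
    by_contra! h
    exact hS (MvPolynomial.funext fun a => by rw [h, map_zero])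
  refine ⟨a, ?_⟩
  rw [← aeval_aeval_update_C]
  refine aeval_ne_zero_of_notMem_range hξ fun h0 => ha ?_
  have := aeval_aeval_update_C S a i (a i)
  rw [h0, map_zero] at this
  simpa [MvPolynomial.aeval_eq_eval] using this.symm

theorem exists_branch_at_infinity [IsAlgClosed k] [IsAlgClosed κ] {P Q : MvPolynomial (Fin 2) k}
    {A B : k} (hA : A ≠ 0) (hB : B ≠ 0) (hPA : (polyInY k P).leadingCoeff = C A)
    (hQB : (polyInY k Q).leadingCoeff = C B) {u v : κ}
    (huv : u ∉ (algebraMap k κ).range ∨ v ∉ (algebraMap k κ).range)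
    (hR : fiberResultant P Q ≠ 0)
    (h : MvPolynomial.aeval ![u, v] (fiberResultant P Q).leadingCoeff = 0) :
    ∃ y : HahnSeries Γ κ, 0 < (evalBranch y P - HahnSeries.C u).orderTop ∧
      0 < (evalBranch y Q - HahnSeries.C v).orderTop := by
  have hlt {u₀ v₀ : κ} (h₀ : MvPolynomial.aeval ![u₀, v₀] (fiberResultant P Q).leadingCoeff ≠ 0) :
      (resultant ((polyInY κ P).map (evalInvT (Γ := Γ)) - C (HahnSeries.C u₀))
        ((polyInY κ Q).map evalInvT - C (HahnSeries.C v₀))).orderTop <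
      (resultant ((polyInY κ P).map (evalInvT (Γ := Γ)) - C (HahnSeries.C u))
        ((polyInY κ Q).map evalInvT - C (HahnSeries.C v))).orderTop := by
    rw [← evalInvT_map_fiberResultant hA hB hPA hQB, ← evalInvT_map_fiberResultant hA hB hPA hQB]
    refine orderTop_evalInvT_lt ((degree_map_lt h hR).trans_eq ?_)
    exact (degree_map_eq_of_leadingCoeff_ne_zero _ h₀).symm
  have hpos {P : MvPolynomial (Fin 2) k} {u : κ} {y : HahnSeries Γ κ}
      (hy : ((polyInY κ P).map (evalInvT (Γ := Γ)) - C (HahnSeries.C u)).eval y = 0) :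
      0 < (evalBranch y P - HahnSeries.C u).orderTop := by
    rw [eval_sub, eval_C, ← evalBranch_eq_eval] at hy
    rw [hy, HahnSeries.orderTop_zero]
    exact WithTop.coe_lt_top 0
  have hR₀ := leadingCoeff_ne_zero.mpr hR
  rcases huv with hu | hv
  · obtain ⟨a, ha⟩ := exists_aeval_update_ne_zero hR₀ 0 hu
    have ha' : Function.update (algebraMap k κ ∘ a) 0 u = ![u, algebraMap k κ (a 1)] := by
      ext i; fin_cases i <;> simp
    obtain ⟨y, hy, hy'⟩ := exists_root_of_orderTop_resultant_lt (hlt (ha' ▸ ha))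
    exact ⟨y, hpos hy, by rwa [evalBranch_eq_eval y Q]⟩
  · obtain ⟨a, ha⟩ := exists_aeval_update_ne_zero hR₀ 1 hv
    have ha' : Function.update (algebraMap k κ ∘ a) 1 v = ![algebraMap k κ (a 0), v] := by
      ext i; fin_cases i <;> simp
    have hlt' := hlt (ha' ▸ ha)
    rw [orderTop_resultant_comm, orderTop_resultant_comm (_ - C (HahnSeries.C u))] at hlt'
    obtain ⟨y, hy, hy'⟩ := exists_root_of_orderTop_resultant_lt hlt'
    exact ⟨y, by rwa [evalBranch_eq_eval y P], hpos hy⟩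

end Branch

section TopForm
variable {Γ σ R : Type*} [AddCommGroup Γ] [LinearOrder Γ] [IsOrderedAddMonoid Γ] [CommRing R]

/-- The substitution `X i ↦ X i t ^ (-w i)`, which turns the grading of `MvPolynomial σ R` by the
weights `w` into the order of a series: an element of weight `a` is a multiple of `t ^ (-a)`. -/
noncomputable def weightHom (w : σ → Γ) :
    MvPolynomial σ R →+* HahnSeries Γ (MvPolynomial σ R) :=
  MvPolynomial.eval₂Hom (HahnSeries.C.comp MvPolynomial.C)
    fun i => HahnSeries.single (-w i) (MvPolynomial.X i)

variable {w : σ → Γ}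

@[simp] theorem weightHom_C (a : R) :
    weightHom w (MvPolynomial.C a) = HahnSeries.C (MvPolynomial.C a) :=
  MvPolynomial.eval₂Hom_C _ _ _

@[simp] theorem weightHom_X (i : σ) :
    weightHom w (MvPolynomial.X i : MvPolynomial σ R) =
      HahnSeries.single (-w i) (MvPolynomial.X i) :=
  MvPolynomial.eval₂Hom_X' _ _ _

theorem weightHom_monomial (m : σ →₀ ℕ) (a : R) :
    weightHom w (MvPolynomial.monomial m a) =
      HahnSeries.single (-Finsupp.weight w m) (MvPolynomial.monomial m a) := by
  induction m using Finsupp.induction_linear generalizing a with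
  | zero => simp [← MvPolynomial.C_apply]
  | add m n hm hn =>
    rw [← mul_one a, ← MvPolynomial.monomial_mul, map_mul, hm, hn, HahnSeries.single_mul_single,
      map_add, neg_add]
  | single i n =>
    rw [← MvPolynomial.C_mul_X_pow_eq_monomial, map_mul, map_pow, weightHom_C, weightHom_X,
      HahnSeries.single_pow, HahnSeries.C_apply, HahnSeries.single_mul_single, zero_add, smul_neg,
      Finsupp.weight_single]

theorem coeff_coeff_weightHom (F : MvPolynomial σ R) (s : Γ) (m : σ →₀ ℕ) :
    ((weightHom w F).coeff s).coeff m = if s = -Finsupp.weight w m then F.coeff m else 0 := by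
  classical
  induction F using MvPolynomial.induction_on' with
  | monomial n a =>
    rw [weightHom_monomial, HahnSeries.coeff_single]
    rcases eq_or_ne n m with rfl | h
    · split_ifs <;> rfl
    · split_ifs <;> simp [MvPolynomial.coeff_monomial, h]
  | add F G hF hG =>
    rw [map_add, HahnSeries.coeff_add, MvPolynomial.coeff_add, hF, hG, MvPolynomial.coeff_add]
    split_ifs <;> simp

theorem weightHom_injective :
    Function.Injective (weightHom w : MvPolynomial σ R → HahnSeries Γ (MvPolynomial σ R)) := by
  rw [injective_iff_map_eq_zero]
  intro F hF
  ext m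
  have := coeff_coeff_weightHom (w := w) F (-Finsupp.weight w m) m
  rw [if_pos rfl, hF] at this
  simpa using this.symm

/-- The part of `F` of highest weight, for the weights `w` of the variables. -/
noncomputable def topForm (w : σ → Γ) (F : MvPolynomial σ R) : MvPolynomial σ R :=
  (weightHom w F).leadingCoeff

theorem topForm_mul [IsDomain R] (F G : MvPolynomial σ R) :
    topForm w (F * G) = topForm w F * topForm w G := by
  rw [topForm, map_mul, HahnSeries.leadingCoeff_mul, topForm, topForm]

theorem topForm_ne_zero {F : MvPolynomial σ R} (hF : F ≠ 0) : topForm w F ≠ 0 :=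
  HahnSeries.leadingCoeff_ne_zero.mpr ((map_ne_zero_iff _ weightHom_injective).mpr hF)

theorem topForm_C (a : R) : topForm w (MvPolynomial.C a) = MvPolynomial.C a := by
  rw [topForm, weightHom_C]
  exact HahnSeries.leadingCoeff_of_single

theorem coeff_topForm (F : MvPolynomial σ R) (m : σ →₀ ℕ) :
    (topForm w F).coeff m =
      if (weightHom w F).order = -Finsupp.weight w m then F.coeff m else 0 := by
  rw [topForm, HahnSeries.leadingCoeff_eq, coeff_coeff_weightHom]

theorem isWeightedHomogeneous_topForm (F : MvPolynomial σ R) :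
    MvPolynomial.IsWeightedHomogeneous w (topForm w F) (-(weightHom w F).order) := by
  intro m hm
  rw [coeff_topForm] at hm
  rw [(ite_ne_right_iff.mp hm).1, neg_neg]

theorem weight_lt_of_mem_support_sub_topForm {F : MvPolynomial σ R} {a : Γ} (hF : F ≠ 0)
    (ha : MvPolynomial.IsWeightedHomogeneous w (topForm w F) a) {m : σ →₀ ℕ}
    (hm : m ∈ (F - topForm w F).support) : Finsupp.weight w m < a := by
  rw [ha.inj_right (topForm_ne_zero hF) (isWeightedHomogeneous_topForm F), lt_neg]
  rw [MvPolynomial.mem_support_iff, MvPolynomial.coeff_sub, coeff_topForm] at hm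
  have hne : (weightHom w F).order ≠ -Finsupp.weight w m := fun h => hm (by rw [if_pos h, sub_self])
  refine lt_of_le_of_ne (HahnSeries.order_le_of_coeff_ne_zero fun h0 => hm ?_) hne
  have := coeff_coeff_weightHom (w := w) F (-Finsupp.weight w m) m
  rw [h0, if_pos rfl, MvPolynomial.coeff_zero] at this
  rw [if_neg hne, ← this, sub_zero]

end TopForm

section WeightedResultant
variable {Γ R : Type*} [CommRing R]

theorem scaleRoots_sub_C (f : R[X]) (c r : R) :
    (f - C c).scaleRoots r = f.scaleRoots r - C (c * r ^ f.natDegree) := by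
  ext i
  rw [coeff_scaleRoots, natDegree_sub_C, coeff_sub, coeff_sub, coeff_scaleRoots, coeff_C, coeff_C]
  split_ifs with hi
  · rw [hi, sub_mul, Nat.sub_zero]
  · rw [sub_zero, sub_zero]

theorem leadingCoeff_eval₂_single [Field Γ] [LinearOrder Γ] [IsStrictOrderedRing Γ] {S : R[X]}
    (hS : S.coeff 0 ≠ 0) {a : Γ} (ha : 0 < a) :
    (S.eval₂ HahnSeries.C (HahnSeries.single a 1)).leadingCoeff = S.coeff 0 := by
  have hF : ((0 : Γ) : WithTop Γ) ≤ (rescale 0 (S.map HahnSeries.C)).orderTop := by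
    rw [le_orderTop_rescale_iff]
    intro i
    rw [mul_zero, sub_zero, coeff_map]
    exact HahnSeries.orderTop_single_le
  have hδ : ((0 : Γ) : WithTop Γ) ≤ (HahnSeries.single a (1 : R)).orderTop :=
    (WithTop.coe_le_coe.mpr ha.le).trans HahnSeries.orderTop_single_le
  have hcoeff : ((S.map HahnSeries.C).eval (HahnSeries.single a 1)).coeff 0 = S.coeff 0 := by
    rw [coeff_eval_of_le_orderTop hF hδ, HahnSeries.coeff_single_of_ne ha.ne,
      ← coeff_zero_eq_eval_zero, coeff_coeff_rescale]
    simp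
  rw [← eval_map, ← hcoeff]
  exact leadingCoeff_eq_of_coeff_ne_zero (le_orderTop_eval hF hδ) (hcoeff ▸ hS)

theorem map_eval_zero_scaleRoots_X [IsDomain R] {p : R[X]} (hp : p ≠ 0) :
    ((p.map C).scaleRoots X).map (evalRingHom 0) = C p.leadingCoeff * X ^ p.natDegree := by
  have hlc : (p.map C).leadingCoeff = C p.leadingCoeff :=
    leadingCoeff_map_of_injective C_injective _
  have hcomp : (evalRingHom (0 : R)).comp C = RingHom.id R := by ext; simp
  rw [map_scaleRoots _ _ _ (by simpa [hlc] using hp), Polynomial.map_map, hcomp, Polynomial.map_id,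
    coe_evalRingHom, eval_X, scaleRoots_zero, smul_eq_C_mul]

theorem map_eval₂_scaleRoots_X [IsDomain R] [AddCommGroup Γ] [LinearOrder Γ]
    [IsOrderedAddMonoid Γ] {p : R[X]} (hp : p ≠ 0) (u : R) (a : Γ) :
    ((p.map C).scaleRoots X - C (C u)).map (eval₂RingHom HahnSeries.C (HahnSeries.single a 1)) =
      (p.map HahnSeries.C - C (HahnSeries.single (-(p.natDegree • a)) u)).scaleRoots
        (HahnSeries.single a 1) := by
  have hlc : (p.map C).leadingCoeff = C p.leadingCoeff :=
    leadingCoeff_map_of_injective C_injective _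
  have hcomp : (eval₂RingHom HahnSeries.C (HahnSeries.single a (1 : R))).comp C = HahnSeries.C := by
    ext; simp
  rw [scaleRoots_sub_C, natDegree_map_eq_of_injective HahnSeries.C_injective,
    HahnSeries.single_pow, HahnSeries.single_mul_single, neg_add_cancel, one_pow, mul_one,
    Polynomial.map_sub, map_scaleRoots _ _ _ (by simpa [hlc] using hp), Polynomial.map_map, hcomp]
  simp

theorem leadingCoeff_resultant_sub_single [IsDomain R] [Field Γ] [LinearOrder Γ]
    [IsStrictOrderedRing Γ] {p q : R[X]} (hp : p ≠ 0) (hq : q ≠ 0) {u v : R} {a : Γ} (ha : 0 < a)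
    (h : resultant (C p.leadingCoeff * X ^ p.natDegree - C u)
      (C q.leadingCoeff * X ^ q.natDegree - C v) p.natDegree q.natDegree ≠ 0) :
    (resultant (p.map HahnSeries.C - C (HahnSeries.single (-(p.natDegree • a)) u))
      (q.map HahnSeries.C - C (HahnSeries.single (-(q.natDegree • a)) v))).leadingCoeff =
      resultant (C p.leadingCoeff * X ^ p.natDegree - C u)
        (C q.leadingCoeff * X ^ q.natDegree - C v) p.natDegree q.natDegree := by
  set E := resultant ((p.map C).scaleRoots X - C (C u)) ((q.map C).scaleRoots X - C (C v))
    p.natDegree q.natDegree with hE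
  have hE₀ : E.coeff 0 = resultant (C p.leadingCoeff * X ^ p.natDegree - C u)
      (C q.leadingCoeff * X ^ q.natDegree - C v) p.natDegree q.natDegree := by
    rw [coeff_zero_eq_eval_zero, ← coe_evalRingHom, hE, ← resultant_map_map, Polynomial.map_sub,
      Polynomial.map_sub, map_eval_zero_scaleRoots_X hp, map_eval_zero_scaleRoots_X hq,
      Polynomial.map_C, Polynomial.map_C, coe_evalRingHom, eval_C, eval_C]
  have hEa : E.eval₂ HahnSeries.C (HahnSeries.single a 1) =
      HahnSeries.single a 1 ^ (p.natDegree * q.natDegree) *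
        resultant (p.map HahnSeries.C - C (HahnSeries.single (-(p.natDegree • a)) u))
          (q.map HahnSeries.C - C (HahnSeries.single (-(q.natDegree • a)) v)) := by
    have hdeg (p : R[X]) (c : HahnSeries Γ R) : (p.map HahnSeries.C - C c).natDegree =
        p.natDegree := by
      rw [natDegree_sub_C, natDegree_map_eq_of_injective HahnSeries.C_injective]
    have := resultant_scaleRoots (p.map HahnSeries.C - C (HahnSeries.single (-(p.natDegree • a)) u))
      (q.map HahnSeries.C - C (HahnSeries.single (-(q.natDegree • a)) v)) (HahnSeries.single a 1)
    rw [natDegree_scaleRoots, natDegree_scaleRoots, hdeg, hdeg] at this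
    rw [hdeg, hdeg, ← this, ← map_eval₂_scaleRoots_X hp, ← map_eval₂_scaleRoots_X hq,
      resultant_map_map]
    rfl
  have hlc := leadingCoeff_eval₂_single (hE₀ ▸ h) ha
  rw [hEa, HahnSeries.leadingCoeff_mul, HahnSeries.single_pow, one_pow,
    HahnSeries.leadingCoeff_of_single, one_mul] at hlc
  exact hlc.trans hE₀

theorem resultant_C_mul_X_pow_sub_C [IsDomain R] {α : R} (hα : α ≠ 0) {m e : ℕ} (hm : m ≠ 0)
    (he : e ≠ 0) (c u w : R) :
    resultant (C α * X ^ m - C u) (C c * X ^ (m * e) - C w) m (m * e) =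
      (c * u ^ e - α ^ e * w) ^ m := by
  have hdeg : (C α * X ^ m - C u).natDegree = m := by
    rw [natDegree_sub_C, natDegree_C_mul_X_pow m α hα]
  have hlc : (C α * X ^ m - C u).coeff m = α := by simp [coeff_C, hm]
  obtain ⟨g, hg⟩ := sub_dvd_pow_sub_pow (C α * X ^ m) (C u) e
  have hgdeg : g.natDegree + m ≤ m * e := by
    rcases eq_or_ne g 0 with rfl | hg₀
    · simpa using Nat.le_mul_of_pos_right m (Nat.pos_of_ne_zero he)
    · have hf : C α * X ^ m - C u ≠ 0 := by rintro h; simp [h] at hdeg; exact hm hdeg.symm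
      have := natDegree_mul hf hg₀
      rw [← hg, ← C_pow, natDegree_sub_C, mul_pow, ← C_pow, ← pow_mul,
        natDegree_C_mul_X_pow _ _ (pow_ne_zero e hα), hdeg] at this
      lia
  have hsplit : C (α ^ e) * (C c * X ^ (m * e) - C w) =
      C (c * u ^ e - α ^ e * w) + (C α * X ^ m - C u) * (C c * g) := by
    simp only [C_sub, C_mul, C_pow]
    linear_combination (C c) * hg
  have hmul := resultant_C_mul_right (C α * X ^ m - C u) (C c * X ^ (m * e) - C w) m (m * e) (α ^ e)
  rw [hsplit, resultant_add_mul_right _ _ _ _ _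
    ((Nat.add_le_add_right (natDegree_C_mul_le c g) m).trans hgdeg) hdeg.le, resultant_C_right,
    hlc, ← pow_mul, mul_comm e] at hmul
  exact (mul_left_cancel₀ (pow_ne_zero _ hα) hmul).symm

theorem resultant_C_mul_X_pow_sub_C_dvd [IsDomain R] {α β : R} (hα : α ≠ 0) (hβ : β ≠ 0)
    {m n d e : ℕ} (hm : m ≠ 0) (he : e ≠ 0) (h : n * d = m * e) (u v : R) :
    resultant (C α * X ^ m - C u) (C β * X ^ n - C v) m n ∣
      (β ^ d * u ^ e - α ^ e * v ^ d) ^ m := by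
  obtain ⟨g, hg⟩ := sub_dvd_pow_sub_pow (C β * X ^ n) (C v) d
  have hg' : C (β ^ d) * X ^ (m * e) - C (v ^ d) = (C β * X ^ n - C v) * g := by
    rw [← hg, mul_pow, ← pow_mul, h, C_pow, C_pow]
  have hdeg : (C β * X ^ n - C v).natDegree = n := by
    rw [natDegree_sub_C, natDegree_C_mul_X_pow n β hβ]
  have hdeg' : (C (β ^ d) * X ^ (m * e) - C (v ^ d)).natDegree = m * e := by
    rw [natDegree_sub_C, natDegree_C_mul_X_pow _ _ (pow_ne_zero d hβ)]
  have hne : (C β * X ^ n - C v) * g ≠ 0 := by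
    rw [← hg']
    rintro h₀
    rw [h₀, natDegree_zero] at hdeg'
    exact mul_ne_zero hm he hdeg'.symm
  have hf : (C α * X ^ m - C u).natDegree ≤ m := by
    rw [natDegree_sub_C]; exact natDegree_C_mul_X_pow_le α m
  have hmul := resultant_mul_right (C α * X ^ m - C u) (C β * X ^ n - C v) g m hf
  rw [← natDegree_mul (left_ne_zero_of_mul hne) (right_ne_zero_of_mul hne), ← hg', hdeg', hdeg,
    resultant_C_mul_X_pow_sub_C hα hm he] at hmul
  exact ⟨_, hmul⟩

end WeightedResultant

section QuasiForm
variable {k : Type*} [Field k] {A B : k} {d e : ℕ}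

/-- The quasi-homogeneous form `B ^ d u ^ e - A ^ e v ^ d`, the equation of the curve
`t ↦ (A t ^ d, B t ^ e)` when `d` and `e` are coprime. -/
noncomputable def quasiForm (A B : k) (d e : ℕ) : MvPolynomial (Fin 2) k :=
  MvPolynomial.C (B ^ d) * MvPolynomial.X 0 ^ e - MvPolynomial.C (A ^ e) * MvPolynomial.X 1 ^ d

theorem quasiForm_ne_zero (hB : B ≠ 0) (hd : d ≠ 0) : quasiForm A B d e ≠ 0 := by
  intro h
  have := congrArg (MvPolynomial.eval ![1, 0]) h
  simp [quasiForm, hd, hB] at this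

theorem isWeightedHomogeneous_quasiForm {M : Type*} [CommRing M] (A B : k) (d e : ℕ) :
    MvPolynomial.IsWeightedHomogeneous ![(d : M), (e : M)] (quasiForm A B d e) (d * e : M) := by
  have hterm (a : k) (i : Fin 2) (n : ℕ) := (MvPolynomial.isWeightedHomogeneous_C _ a).mul
    ((MvPolynomial.isWeightedHomogeneous_X k ![(d : M), (e : M)] i).pow n)
  have hu := hterm (B ^ d) 0 e
  have hv := hterm (A ^ e) 1 d
  simp only [Matrix.cons_val_zero, Matrix.cons_val_one, zero_add, nsmul_eq_mul] at hu hv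
  rw [mul_comm (e : M) d] at hu
  exact (MvPolynomial.weightedHomogeneousSubmodule k _ _).sub_mem hu hv

theorem exists_support_of_aeval_eq_zero (hA : A ≠ 0) (hB : B ≠ 0) {F : MvPolynomial (Fin 2) k}
    (hF : F ≠ 0) (h : MvPolynomial.aeval ![C A * X ^ d, C B * X ^ e] F = (0 : k[X])) :
    ∃ m ∈ F.support, ∃ n ∈ F.support, m ≠ n ∧ d * m 0 + e * m 1 = d * n 0 + e * n 1 := by
  obtain ⟨m, hm⟩ := MvPolynomial.support_nonempty.mpr hF
  refine ⟨m, hm, ?_⟩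
  by_contra! hne
  have hcoeff := congrArg (coeff · (d * m 0 + e * m 1)) h
  have hterm (n : Fin 2 →₀ ℕ) : MvPolynomial.aeval ![C A * X ^ d, C B * X ^ e]
      (MvPolynomial.monomial n (F.coeff n)) =
        C (F.coeff n * A ^ n 0 * B ^ n 1) * X ^ (d * n 0 + e * n 1) := by
    rw [MvPolynomial.aeval_monomial, Finsupp.prod_fintype _ _ (by simp), Fin.prod_univ_two]
    simp only [algebraMap_eq, Matrix.cons_val_zero, Matrix.cons_val_one, C_mul, C_pow]
    ring
  rw [F.as_sum, map_sum] at hcoeff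
  simp only [hterm, finsetSum_coeff, coeff_C_mul_X_pow, coeff_zero] at hcoeff
  rw [Finset.sum_eq_single_of_mem m hm fun n hn hnm => if_neg (hne n hn hnm.symm),
    if_pos rfl] at hcoeff
  exact mul_ne_zero (mul_ne_zero (MvPolynomial.mem_support_iff.mp hm) (pow_ne_zero _ hA))
    (pow_ne_zero _ hB) hcoeff

theorem le_of_weight_eq (hd : d ≠ 0) (hde : d.Coprime e) {a b a' b' : ℕ}
    (hne : a ≠ a') (h : d * a + e * b = d * a' + e * b') : e ≤ max a a' ∧ d ≤ max b b' := by
  wlog hlt : a < a' generalizing a b a' b'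
  · rw [max_comm a, max_comm b]
    exact this hne.symm h.symm (lt_of_le_of_ne (not_lt.mp hlt) hne.symm)
  obtain ⟨x, rfl⟩ := Nat.exists_eq_add_of_lt hlt
  have hlt' : b' < b := by
    by_contra! hle
    have := Nat.mul_le_mul_left e hle
    have := Nat.mul_lt_mul_of_pos_left hlt (Nat.pos_of_ne_zero hd)
    lia
  obtain ⟨y, rfl⟩ := Nat.exists_eq_add_of_lt hlt'
  have hxy : d * (x + 1) = e * (y + 1) := by linarith
  have hex : e ≤ x + 1 := Nat.le_of_dvd x.succ_pos (hde.symm.dvd_of_dvd_mul_left ⟨_, hxy⟩)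
  have hdy : d ≤ y + 1 := Nat.le_of_dvd y.succ_pos (hde.dvd_of_dvd_mul_left ⟨_, hxy.symm⟩)
  lia

theorem le_degreeOf_of_aeval_eq_zero (hd : d ≠ 0) (he : e ≠ 0) (hde : d.Coprime e) (hA : A ≠ 0)
    (hB : B ≠ 0) {F : MvPolynomial (Fin 2) k} (hF : F ≠ 0)
    (h : MvPolynomial.aeval ![C A * X ^ d, C B * X ^ e] F = (0 : k[X])) :
    e ≤ F.degreeOf 0 ∧ d ≤ F.degreeOf 1 := by
  obtain ⟨m, hm, n, hn, hmn, hw⟩ := exists_support_of_aeval_eq_zero hA hB hF h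
  have hne : m 0 ≠ n 0 := by
    intro h0
    refine hmn (Finsupp.ext fun i => ?_)
    rw [h0, Nat.add_left_cancel_iff] at hw
    fin_cases i
    exacts [h0, Nat.eq_of_mul_eq_mul_left (Nat.pos_of_ne_zero he) hw]
  obtain ⟨h0, h1⟩ := le_of_weight_eq hd hde hne hw
  exact ⟨h0.trans (max_le (MvPolynomial.monomial_le_degreeOf 0 hm)
      (MvPolynomial.monomial_le_degreeOf 0 hn)),
    h1.trans (max_le (MvPolynomial.monomial_le_degreeOf 1 hm)
      (MvPolynomial.monomial_le_degreeOf 1 hn))⟩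

theorem eq_C_of_degreeOf_eq_zero {σ R : Type*} [CommSemiring R] {F : MvPolynomial σ R}
    (h : ∀ i, F.degreeOf i = 0) : F = MvPolynomial.C (F.coeff 0) := by
  classical
  ext m
  rw [MvPolynomial.coeff_C]
  split_ifs with hm
  · rw [hm]
  · refine MvPolynomial.notMem_support_iff.mp fun hms => hm (Finsupp.ext fun i => ?_)
    exact (Nat.le_zero.mp ((MvPolynomial.monomial_le_degreeOf i hms).trans_eq (h i))).symm

theorem isUnit_of_degreeOf_eq_zero {σ : Type*} {F : MvPolynomial σ k} (hF : F ≠ 0)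
    (h : ∀ i, F.degreeOf i = 0) : IsUnit F := by
  rw [eq_C_of_degreeOf_eq_zero h] at hF ⊢
  exact (isUnit_iff_ne_zero.mpr fun h0 => hF (by rw [h0, map_zero])).map MvPolynomial.C

theorem degreeOf_quasiForm_le (A B : k) (d e : ℕ) :
    (quasiForm A B d e).degreeOf 0 ≤ e ∧ (quasiForm A B d e).degreeOf 1 ≤ d := by
  have hterm (i j : Fin 2) (a : k) (n : ℕ) :
      (MvPolynomial.C a * MvPolynomial.X j ^ n).degreeOf i ≤ if i = j then n else 0 := by
    refine (MvPolynomial.degreeOf_C_mul_le _ _ _).trans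
      ((MvPolynomial.degreeOf_pow_le _ _ _).trans ?_)
    rw [MvPolynomial.degreeOf_X]
    split_ifs <;> simp
  exact ⟨(MvPolynomial.degreeOf_sub_le _ _ _).trans
      (max_le (hterm _ _ _ _) ((hterm _ _ _ _).trans (Nat.zero_le e))),
    (MvPolynomial.degreeOf_sub_le _ _ _).trans
      (max_le ((hterm _ _ _ _).trans (Nat.zero_le d)) (hterm _ _ _ _))⟩

theorem isUnit_of_quasiForm_eq_mul (hd : d ≠ 0) (he : e ≠ 0) (hde : d.Coprime e) (hA : A ≠ 0)
    (hB : B ≠ 0) {F G : MvPolynomial (Fin 2) k} (hFG : quasiForm A B d e = F * G)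
    (h : MvPolynomial.aeval ![C A * X ^ d, C B * X ^ e] F = (0 : k[X])) : IsUnit G := by
  have hne : F * G ≠ 0 := hFG ▸ quasiForm_ne_zero hB hd
  have hF := left_ne_zero_of_mul hne
  have hG := right_ne_zero_of_mul hne
  obtain ⟨hF₀, hF₁⟩ := le_degreeOf_of_aeval_eq_zero hd he hde hA hB hF h
  obtain ⟨h₀, h₁⟩ := degreeOf_quasiForm_le A B d e
  rw [hFG, MvPolynomial.degreeOf_mul_eq hF hG] at h₀ h₁
  refine isUnit_of_degreeOf_eq_zero hG fun i => ?_
  fin_cases i <;> simp only [Fin.zero_eta, Fin.mk_one] <;> lia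

theorem prime_quasiForm (hd : d ≠ 0) (he : e ≠ 0) (hde : d.Coprime e) (hA : A ≠ 0) (hB : B ≠ 0) :
    Prime (quasiForm A B d e) := by
  have hzero : MvPolynomial.aeval ![C A * X ^ d, C B * X ^ e] (quasiForm A B d e) = (0 : k[X]) := by
    simp only [quasiForm, map_sub, map_mul, map_pow, MvPolynomial.aeval_X, MvPolynomial.aeval_C,
      algebraMap_eq, Matrix.cons_val_zero, Matrix.cons_val_one]
    ring
  refine Irreducible.prime ⟨fun hu => ?_, fun F G hFG => ?_⟩
  · exact not_isUnit_zero (hzero ▸ hu.map (MvPolynomial.aeval ![C A * X ^ d, C B * X ^ e]))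
  · rw [hFG, map_mul, mul_eq_zero] at hzero
    exact hzero.elim (fun h => .inr (isUnit_of_quasiForm_eq_mul hd he hde hA hB hFG h))
      fun h => .inl (isUnit_of_quasiForm_eq_mul hd he hde hA hB (hFG.trans (mul_comm F G)) h)

theorem quasiForm_dvd_quasiForm {α β : k} (hα : α ≠ 0)
    (h : B ^ d * α ^ e = A ^ e * β ^ d) : quasiForm α β d e ∣ quasiForm A B d e := by
  have hαA : MvPolynomial.C (α ^ e) * quasiForm A B d e =
      MvPolynomial.C (A ^ e) * quasiForm α β d e := by
    have hC := congrArg (MvPolynomial.C (σ := Fin 2)) h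
    simp only [MvPolynomial.C_mul] at hC
    rw [quasiForm, quasiForm]
    linear_combination MvPolynomial.X 0 ^ e * hC
  have hu : IsUnit (MvPolynomial.C (α ^ e) : MvPolynomial (Fin 2) k) :=
    (isUnit_iff_ne_zero.mpr (pow_ne_zero _ hα)).map MvPolynomial.C
  rw [← hu.dvd_mul_left, hαA]
  exact dvd_mul_left _ _

theorem exists_eq_C_mul_quasiForm_pow_add (hd : d ≠ 0) (he : e ≠ 0) (hde : d.Coprime e)
    (hA : A ≠ 0) (hB : B ≠ 0) {F : MvPolynomial (Fin 2) k} (hF : F ≠ 0) {n : ℕ}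
    (h : topForm ![(d : ℚ), (e : ℚ)] F ∣ quasiForm A B d e ^ n) :
    ∃ (c : k) (M : ℕ) (S : MvPolynomial (Fin 2) k), c ≠ 0 ∧
      (∀ s ∈ S.support, s 0 * d + s 1 * e < M * d * e) ∧
      F = MvPolynomial.C c * quasiForm A B d e ^ M + S := by
  obtain ⟨M, -, hM⟩ := (dvd_prime_pow (prime_quasiForm hd he hde hA hB) n).mp h
  obtain ⟨w, hw⟩ := hM.symm
  obtain ⟨c, hc, hcw⟩ := MvPolynomial.isUnit_iff_eq_C_of_isReduced.mp w.isUnit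
  rw [hcw, mul_comm] at hw
  have hhom := (MvPolynomial.isWeightedHomogeneous_C ![(d : ℚ), (e : ℚ)] c).mul
    ((isWeightedHomogeneous_quasiForm A B d e).pow M)
  rw [hw] at hhom
  refine ⟨c, M, F - topForm ![(d : ℚ), (e : ℚ)] F, hc.ne_zero, fun s hs => ?_, by rw [hw]; ring⟩
  have hlt := weight_lt_of_mem_support_sub_topForm hF hhom hs
  rw [Finsupp.weight_apply, Finsupp.sum_fintype _ _ (by simp), Fin.sum_univ_two] at hlt
  simp only [Matrix.cons_val_zero, Matrix.cons_val_one, nsmul_eq_mul, zero_add, ← mul_assoc] at hlt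
  exact_mod_cast hlt

end QuasiForm

section CurveResultant
variable {k : Type*} [Field k] {p q : k[X]}

/-- The resultant of `p - u` and `q - v`, an equation of the curve parametrized by `p` and `q`. -/
noncomputable def curveResultant (p q : k[X]) : MvPolynomial (Fin 2) k :=
  resultant (p.map MvPolynomial.C - C (MvPolynomial.X 0))
    (q.map MvPolynomial.C - C (MvPolynomial.X 1))

theorem aeval_curveResultant_eq_zero {κ : Type*} [Field κ] [Algebra k κ] (hp : p.natDegree ≠ 0)
    (ξ : κ) : MvPolynomial.aeval ![p.aeval ξ, q.aeval ξ] (curveResultant p q) = 0 := by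
  obtain ⟨f, g, -, -, hfg⟩ := exists_mul_add_mul_eq_C_resultant
    (p.map MvPolynomial.C - C (MvPolynomial.X 0 : MvPolynomial (Fin 2) k))
    (q.map MvPolynomial.C - C (MvPolynomial.X 1)) le_rfl le_rfl
    (.inl (by rwa [natDegree_sub_C, natDegree_map_eq_of_injective (MvPolynomial.C_injective _ _)]))
  set φ : MvPolynomial (Fin 2) k →+* κ :=
    (MvPolynomial.aeval ![p.aeval ξ, q.aeval ξ] : MvPolynomial (Fin 2) k →ₐ[k] κ).toRingHom
  have hφC : φ.comp MvPolynomial.C = algebraMap k κ :=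
    RingHom.ext fun a => MvPolynomial.aeval_C _ a
  have hp0 : φ (MvPolynomial.X 0) = p.eval₂ (algebraMap k κ) ξ := MvPolynomial.aeval_X _ _
  have hq0 : φ (MvPolynomial.X 1) = q.eval₂ (algebraMap k κ) ξ := MvPolynomial.aeval_X _ _
  have := congrArg (Polynomial.eval₂ φ ξ) hfg
  rw [eval₂_add, eval₂_mul, eval₂_mul, eval₂_sub, eval₂_sub, eval₂_map, eval₂_map, eval₂_C,
    eval₂_C, eval₂_C, hφC, hp0, hq0, sub_self, sub_self, zero_mul, zero_mul, zero_add] at this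
  exact this.symm

theorem weightHom_curveResultant {Γ : Type*} [AddCommGroup Γ] [LinearOrder Γ]
    [IsOrderedAddMonoid Γ] (w : Fin 2 → Γ) (p q : k[X]) : weightHom w (curveResultant p q) =
      resultant ((p.map MvPolynomial.C).map HahnSeries.C -
          C (HahnSeries.single (-w 0) (MvPolynomial.X 0)))
        ((q.map MvPolynomial.C).map HahnSeries.C -
          C (HahnSeries.single (-w 1) (MvPolynomial.X 1))) := by
  have hC : (weightHom w).comp MvPolynomial.C = HahnSeries.C.comp (MvPolynomial.C (R := k)) :=
    RingHom.ext weightHom_C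
  rw [curveResultant, ← resultant_map_map, Polynomial.map_sub, Polynomial.map_sub,
    Polynomial.map_map, Polynomial.map_map, hC, Polynomial.map_C, Polynomial.map_C, weightHom_X,
    weightHom_X, ← Polynomial.map_map, ← Polynomial.map_map]
  have hdeg (p : k[X]) (c : MvPolynomial (Fin 2) k) (c' : HahnSeries Γ (MvPolynomial (Fin 2) k)) :
      (p.map MvPolynomial.C - C c).natDegree =
        ((p.map MvPolynomial.C).map HahnSeries.C - C c').natDegree := by
    rw [natDegree_sub_C, natDegree_sub_C]
    exact (natDegree_map_eq_of_injective HahnSeries.C_injective _).symm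
  rw [hdeg p, hdeg q]

theorem topForm_curveResultant {d e j : ℕ} (hj : j ≠ 0) (hp : p.natDegree = d * j)
    (hq : q.natDegree = e * j) (hp₀ : p ≠ 0) (hq₀ : q ≠ 0)
    (hne : resultant (C (MvPolynomial.C p.leadingCoeff) * X ^ (d * j) - C (MvPolynomial.X 0))
      (C (MvPolynomial.C q.leadingCoeff) * X ^ (e * j) - C (MvPolynomial.X (1 : Fin 2))) (d * j)
      (e * j) ≠ 0) :
    topForm ![(d : ℚ), (e : ℚ)] (curveResultant p q) =
      resultant (C (MvPolynomial.C p.leadingCoeff) * X ^ (d * j) - C (MvPolynomial.X 0))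
        (C (MvPolynomial.C q.leadingCoeff) * X ^ (e * j) - C (MvPolynomial.X 1)) (d * j)
        (e * j) := by
  have hinj := MvPolynomial.C_injective (Fin 2) k
  have hw (n : ℕ) : (n * j) • (j : ℚ)⁻¹ = n := by
    rw [nsmul_eq_mul, Nat.cast_mul, mul_inv_cancel_right₀ (Nat.cast_ne_zero.mpr hj)]
  have := leadingCoeff_resultant_sub_single (p := p.map MvPolynomial.C)
    (q := q.map MvPolynomial.C) (u := MvPolynomial.X 0) (v := MvPolynomial.X 1)
    ((Polynomial.map_ne_zero_iff hinj).mpr hp₀) ((Polynomial.map_ne_zero_iff hinj).mpr hq₀)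
    (inv_pos.mpr (Nat.cast_pos.mpr (Nat.pos_of_ne_zero hj)) : 0 < (j : ℚ)⁻¹)
  rw [leadingCoeff_map_of_injective hinj, leadingCoeff_map_of_injective hinj,
    natDegree_map_eq_of_injective hinj, natDegree_map_eq_of_injective hinj, hp, hq, hw, hw] at this
  rw [topForm, weightHom_curveResultant]
  exact this hne

theorem topForm_curveResultant_dvd {A B : k} {d e j : ℕ} (hd : d ≠ 0) (he : e ≠ 0)
    (hj : j ≠ 0) (hp : p.natDegree = d * j) (hq : q.natDegree = e * j)
    (hpq : B ^ d * p.leadingCoeff ^ e = A ^ e * q.leadingCoeff ^ d) :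
    curveResultant p q ≠ 0 ∧
      ∃ n, topForm ![(d : ℚ), (e : ℚ)] (curveResultant p q) ∣ quasiForm A B d e ^ n := by
  have hp₀ : p ≠ 0 := fun h => mul_ne_zero hd hj (by rw [← hp, h, natDegree_zero])
  have hq₀ : q ≠ 0 := fun h => mul_ne_zero he hj (by rw [← hq, h, natDegree_zero])
  have hα := leadingCoeff_ne_zero.mpr hp₀
  have hβ := leadingCoeff_ne_zero.mpr hq₀
  have hC {a : k} (ha : a ≠ 0) : (MvPolynomial.C a : MvPolynomial (Fin 2) k) ≠ 0 :=
    (map_ne_zero_iff _ (MvPolynomial.C_injective _ _)).mpr ha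
  have hdvd := resultant_C_mul_X_pow_sub_C_dvd (hC hα) (hC hβ) (mul_ne_zero hd hj) he
    (m := d * j) (n := e * j) (d := d) (by ring) (MvPolynomial.X 0) (MvPolynomial.X 1)
  rw [← MvPolynomial.C_pow, ← MvPolynomial.C_pow] at hdvd
  have hne := ne_zero_of_dvd_ne_zero (pow_ne_zero _ (quasiForm_ne_zero hβ hd)) hdvd
  have htop := topForm_curveResultant hj hp hq hp₀ hq₀ hne
  refine ⟨fun h0 => hne ?_, d * j, ?_⟩
  · rw [← htop, h0, topForm, map_zero, HahnSeries.leadingCoeff_zero]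
  · rw [htop]
    exact hdvd.trans (pow_dvd_pow_of_dvd (quasiForm_dvd_quasiForm hα hpq) _)

end CurveResultant

section FiberResultant
variable {k : Type*} [Field k] {P Q : MvPolynomial (Fin 2) k} {A B : k}

theorem eval_zero_fiberResultant (hA : A ≠ 0) (hB : B ≠ 0)
    (hPA : (polyInY k P).leadingCoeff = C A) (hQB : (polyInY k Q).leadingCoeff = C B) :
    (fiberResultant P Q).eval 0 =
      curveResultant ((polyInY k P).map (evalRingHom 0)) ((polyInY k Q).map (evalRingHom 0)) := by
  have hcomp : (evalRingHom (0 : MvPolynomial (Fin 2) k)).comp (mapRingHom MvPolynomial.C) =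
      MvPolynomial.C.comp (evalRingHom 0) := by
    ext <;> simp
  have hmap (P : MvPolynomial (Fin 2) k) (i : Fin 2) :
      (polyInY (MvPolynomial (Fin 2) k) P - C (C (MvPolynomial.X i))).map (evalRingHom 0) =
        ((polyInY k P).map (evalRingHom 0)).map MvPolynomial.C - C (MvPolynomial.X i) := by
    rw [Polynomial.map_sub, ← map_polyInY (IsScalarTower.toAlgHom k k _), Polynomial.map_map,
      Polynomial.map_map, Polynomial.map_C, coe_evalRingHom, eval_C]
    exact congrArg (fun f => (polyInY k P).map f - C (MvPolynomial.X i)) hcomp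
  have hdeg {P : MvPolynomial (Fin 2) k} {A : k} (hA : A ≠ 0)
      (hPA : (polyInY k P).leadingCoeff = C A) (i : Fin 2) :
      (polyInY (MvPolynomial (Fin 2) k) P - C (C (MvPolynomial.X i))).natDegree =
        (((polyInY k P).map (evalRingHom 0)).map MvPolynomial.C -
          C (MvPolynomial.X (R := k) i)).natDegree := by
    rw [natDegree_sub_C, natDegree_sub_C, (natDegree_leadingCoeff_polyInY hA hPA).1,
      natDegree_map_eq_of_injective (MvPolynomial.C_injective _ _),
      natDegree_map_of_leadingCoeff_ne_zero _ (by simpa [hPA] using hA)]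
  rw [← coe_evalRingHom, fiberResultant, ← resultant_map_map, hmap, hmap, hdeg hA hPA,
    hdeg hB hQB, curveResultant]

theorem fiberResultant_of_natDegree_left (hA : A ≠ 0) (hB : B ≠ 0)
    (hPA : (polyInY k P).leadingCoeff = C A) (hQB : (polyInY k Q).leadingCoeff = C B)
    (hP : (polyInY k P).natDegree = 0) :
    fiberResultant P Q =
      C ((MvPolynomial.C A - MvPolynomial.X 0) ^ (polyInY k Q).natDegree) := by
  obtain ⟨hdP, hlP⟩ := natDegree_leadingCoeff_polyInY (S := MvPolynomial (Fin 2) k) hA hPA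
  rw [leadingCoeff, hdP, hP] at hlP
  rw [fiberResultant, natDegree_sub_C, natDegree_sub_C, hdP, hP,
    (natDegree_leadingCoeff_polyInY hB hQB).1, resultant_zero_left_deg, coeff_sub, coeff_C_zero,
    hlP, C_pow, C_sub, MvPolynomial.algebraMap_eq]

theorem fiberResultant_of_natDegree_right (hA : A ≠ 0) (hB : B ≠ 0)
    (hPA : (polyInY k P).leadingCoeff = C A) (hQB : (polyInY k Q).leadingCoeff = C B)
    (hQ : (polyInY k Q).natDegree = 0) :
    fiberResultant P Q =
      C ((MvPolynomial.C B - MvPolynomial.X 1) ^ (polyInY k P).natDegree) := by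
  obtain ⟨hdQ, hlQ⟩ := natDegree_leadingCoeff_polyInY (S := MvPolynomial (Fin 2) k) hB hQB
  rw [leadingCoeff, hdQ, hQ] at hlQ
  rw [fiberResultant, natDegree_sub_C, natDegree_sub_C, hdQ, hQ,
    (natDegree_leadingCoeff_polyInY hA hPA).1, resultant_zero_right_deg, coeff_sub, coeff_C_zero,
    hlQ, C_pow, C_sub, MvPolynomial.algebraMap_eq]

theorem fiberResultant_ne_zero {K d e : ℕ} (hd : d ≠ 0) (he : e ≠ 0) (hA : A ≠ 0) (hB : B ≠ 0)
    (hPy : (polyInY k P).natDegree = K * d) (hPA : (polyInY k P).leadingCoeff = C A)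
    (hQy : (polyInY k Q).natDegree = K * e) (hQB : (polyInY k Q).leadingCoeff = C B) :
    fiberResultant P Q ≠ 0 := by
  rcases eq_or_ne K 0 with rfl | hK
  · rw [zero_mul] at hPy hQy
    rw [fiberResultant_of_natDegree_left hA hB hPA hQB hPy, hQy, pow_zero, C_1]
    exact one_ne_zero
  have hmap {P : MvPolynomial (Fin 2) k} {A : k} (hA : A ≠ 0)
      (hPA : (polyInY k P).leadingCoeff = C A) :
      ((polyInY k P).map (evalRingHom 0)).natDegree = (polyInY k P).natDegree ∧
        ((polyInY k P).map (evalRingHom 0)).leadingCoeff = A := by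
    have h₀ : evalRingHom 0 (polyInY k P).leadingCoeff = A := by simp [hPA]
    exact ⟨natDegree_map_of_leadingCoeff_ne_zero _ (h₀.trans_ne hA),
      (leadingCoeff_map_of_leadingCoeff_ne_zero _ (h₀.trans_ne hA)).trans h₀⟩
  intro hR
  have hcurve := eval_zero_fiberResultant hA hB hPA hQB
  rw [hR, eval_zero] at hcurve
  refine (topForm_curveResultant_dvd hd he hK (A := A) (B := B) ?_ ?_ ?_).1 hcurve.symm
  · rw [(hmap hA hPA).1, hPy, mul_comm]
  · rw [(hmap hB hQB).1, hQy, mul_comm]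
  · rw [(hmap hA hPA).2, (hmap hB hQB).2, mul_comm]

end FiberResultant

section GenericZero

theorem exists_generic_zero.{u, v} {σ : Type u} {k : Type v} [Field k] {F : MvPolynomial σ k}
    (hF : Prime F) :
    ∃ (κ : Type max u v) (_ : Field κ) (_ : IsAlgClosed κ) (_ : Algebra k κ) (a : σ → κ),
      ∀ H, MvPolynomial.aeval a H = 0 ↔ F ∣ H := by
  have hI : (Ideal.span {F}).IsPrime := (Ideal.span_singleton_prime hF.ne_zero).mpr hF
  let S := MvPolynomial σ k ⧸ Ideal.span {F}
  let κ := AlgebraicClosure (FractionRing S)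
  let φ : MvPolynomial σ k →ₐ[k] κ :=
    (IsScalarTower.toAlgHom k S κ).comp (Ideal.Quotient.mkₐ k _)
  refine ⟨κ, inferInstance, inferInstance, inferInstance, fun i => φ (MvPolynomial.X i),
    fun H => ?_⟩
  have hφ : MvPolynomial.aeval (fun i => φ (MvPolynomial.X i)) = φ :=
    MvPolynomial.algHom_ext fun i => MvPolynomial.aeval_X _ _
  have hinj : Function.Injective (algebraMap S κ) :=
    (algebraMap (FractionRing S) κ).injective.comp (IsFractionRing.injective S _)
  rw [hφ, ← Ideal.mem_span_singleton, ← Ideal.Quotient.eq_zero_iff_mem]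
  exact map_eq_zero_iff _ hinj

theorem isUnit_of_dvd_X_sub_C {k : Type*} [Field k] {F : MvPolynomial (Fin 2) k} {a b : k}
    (ha : F ∣ MvPolynomial.X 0 - MvPolynomial.C a)
    (hb : F ∣ MvPolynomial.X 1 - MvPolynomial.C b) : IsUnit F := by
  have hX (i : Fin 2) (c : k) :
      (MvPolynomial.X i - MvPolynomial.C c : MvPolynomial (Fin 2) k) ≠ 0 := by
    intro h
    simpa using congrArg (MvPolynomial.eval fun _ => c + 1) h
  have hdeg {i l : Fin 2} {c : k} (hil : l ≠ i) (h : F ∣ MvPolynomial.X i - MvPolynomial.C c) :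
      F.degreeOf l = 0 := by
    obtain ⟨G, hG⟩ := h
    have hFG : F * G ≠ 0 := hG ▸ hX i c
    have hle := MvPolynomial.degreeOf_sub_le l (MvPolynomial.X i) (MvPolynomial.C c)
    rw [hG, MvPolynomial.degreeOf_mul_eq (left_ne_zero_of_mul hFG) (right_ne_zero_of_mul hFG),
      MvPolynomial.degreeOf_C, MvPolynomial.degreeOf_X, if_neg hil] at hle
    lia
  refine isUnit_of_degreeOf_eq_zero (ne_zero_of_dvd_ne_zero (hX 0 a) ha) fun i => ?_
  fin_cases i
  exacts [hdeg zero_ne_one hb, hdeg one_ne_zero ha]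

end GenericZero

section LeadingCoefficient
variable {k : Type*} [Field k] [IsAlgClosed k] [CharZero k] {P Q : MvPolynomial (Fin 2) k}
  {K d e : ℕ} {A B : k}

theorem topForm_dvd_of_irreducible (hJ : ∃ c, jacobian P Q = MvPolynomial.C c) (hd : d ≠ 0)
    (he : e ≠ 0) (hde : d.Coprime e) (hA : A ≠ 0) (hB : B ≠ 0)
    (hPy : (polyInY k P).natDegree = K * d) (hPA : (polyInY k P).leadingCoeff = C A)
    (hQy : (polyInY k Q).natDegree = K * e) (hQB : (polyInY k Q).leadingCoeff = C B)
    {F : MvPolynomial (Fin 2) k} (hF : Irreducible F)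
    (hFR : F ∣ (fiberResultant P Q).leadingCoeff) :
    ∃ n, topForm ![(d : ℚ), (e : ℚ)] F ∣ quasiForm A B d e ^ n := by
  obtain ⟨κ, _, _, _, a, hκ⟩ := exists_generic_zero hF.prime
  obtain ⟨u, v, rfl⟩ : ∃ u v, a = ![u, v] := ⟨a 0, a 1, (FinVec.etaExpand_eq a).symm⟩
  have hsub (i : Fin 2) (c : k) (h : algebraMap k κ c = ![u, v] i) :
      F ∣ MvPolynomial.X i - MvPolynomial.C c := by
    rw [← hκ, map_sub, MvPolynomial.aeval_X, MvPolynomial.aeval_C, h, sub_self]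
  have huv : u ∉ (algebraMap k κ).range ∨ v ∉ (algebraMap k κ).range := by
    by_contra! huv
    obtain ⟨⟨b, hb⟩, c, hc⟩ := huv
    exact hF.not_isUnit (isUnit_of_dvd_X_sub_C (hsub 0 b hb) (hsub 1 c hc))
  have hR := fiberResultant_ne_zero hd he hA hB hPy hPA hQy hQB
  obtain ⟨y, hyP, hyQ⟩ := exists_branch_at_infinity (Γ := ℝ) hA hB hPA hQB huv hR ((hκ _).mpr hFR)
  have hu := coeff_zero_eq_of_orderTop_sub_C_pos hyP
  have hv := coeff_zero_eq_of_orderTop_sub_C_pos hyQ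
  obtain ⟨ξ, p, q, j, hj, hp, hq, hpq, hpξ, hqξ⟩ :=
    exists_polynomial_curve hJ hd he hde hA hB hPy hPA hQy hQB
      (orderTop_nonneg_of_orderTop_sub_C_pos hyP) (orderTop_nonneg_of_orderTop_sub_C_pos hyQ)
      (by rwa [hu, hv])
  have hzero := aeval_curveResultant_eq_zero (q := q) (hp.trans_ne (mul_ne_zero hd hj)) ξ
  rw [hpξ, hqξ, hu, hv, hκ] at hzero
  obtain ⟨G, hG⟩ := hzero
  obtain ⟨-, n, hn⟩ := topForm_curveResultant_dvd hd he hj hp hq hpq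
  rw [hG, topForm_mul] at hn
  exact ⟨n, (dvd_mul_right _ _).trans hn⟩

theorem topForm_dvd_of_dvd (hJ : ∃ c, jacobian P Q = MvPolynomial.C c) (hd : d ≠ 0)
    (he : e ≠ 0) (hde : d.Coprime e) (hA : A ≠ 0) (hB : B ≠ 0)
    (hPy : (polyInY k P).natDegree = K * d) (hPA : (polyInY k P).leadingCoeff = C A)
    (hQy : (polyInY k Q).natDegree = K * e) (hQB : (polyInY k Q).leadingCoeff = C B)
    {F : MvPolynomial (Fin 2) k} (hFR : F ∣ (fiberResultant P Q).leadingCoeff) :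
    ∃ n, topForm ![(d : ℚ), (e : ℚ)] F ∣ quasiForm A B d e ^ n := by
  induction F using WfDvdMonoid.induction_on_irreducible with
  | zero =>
    have hR := fiberResultant_ne_zero hd he hA hB hPy hPA hQy hQB
    exact absurd (zero_dvd_iff.mp hFR) (leadingCoeff_ne_zero.mpr hR)
  | unit F hF =>
    obtain ⟨c, -, rfl⟩ := MvPolynomial.isUnit_iff_eq_C_of_isReduced.mp hF
    exact ⟨0, by rw [topForm_C]; exact hF.dvd⟩
  | mul G F _ hF ih =>
    obtain ⟨m, hm⟩ := ih ((dvd_mul_left _ _).trans hFR)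
    obtain ⟨n, hn⟩ := topForm_dvd_of_irreducible hJ hd he hde hA hB hPy hPA hQy hQB hF
      ((dvd_mul_right _ _).trans hFR)
    exact ⟨n + m, by rw [topForm_mul, pow_add]; exact mul_dvd_mul hn hm⟩

end LeadingCoefficient

theorem corollary1_general {k : Type*} [Field k] [IsAlgClosed k] [CharZero k]
    {P Q : MvPolynomial (Fin 2) k} {K d e : ℕ} {A B : k}
    (hJ : ∃ c, jacobian P Q = MvPolynomial.C c) (hde : d.Coprime e) (hA : A ≠ 0) (hB : B ≠ 0)
    (hPy : (polyInY k P).natDegree = K * d) (hPA : (polyInY k P).leadingCoeff = C A)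
    (hQy : (polyInY k Q).natDegree = K * e) (hQB : (polyInY k Q).leadingCoeff = C B) :
    ∃ (c : k) (M : ℕ) (S : MvPolynomial (Fin 2) k), c ≠ 0 ∧
      (∀ s ∈ S.support, s 0 * d + s 1 * e < M * d * e) ∧
      (fiberResultant P Q).leadingCoeff = MvPolynomial.C c * quasiForm A B d e ^ M + S := by
  rcases eq_or_ne d 0 with rfl | hd
  · obtain rfl : e = 1 := (Nat.coprime_zero_left e).mp hde
    rw [mul_zero] at hPy
    refine ⟨(-1) ^ K, K, 0, pow_ne_zero _ (neg_ne_zero.mpr one_ne_zero), by simp, ?_⟩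
    rw [fiberResultant_of_natDegree_left hA hB hPA hQB hPy, hQy, leadingCoeff_C, mul_one,
      MvPolynomial.C_pow, ← mul_pow, add_zero, quasiForm]
    congr 1
    simp
  rcases eq_or_ne e 0 with rfl | he
  · obtain rfl : d = 1 := (Nat.coprime_zero_right d).mp hde
    rw [mul_zero] at hQy
    refine ⟨1, K, 0, one_ne_zero, by simp, ?_⟩
    rw [fiberResultant_of_natDegree_right hA hB hPA hQB hQy, hPy, leadingCoeff_C, mul_one,
      quasiForm]
    simp
  obtain ⟨n, hn⟩ := topForm_dvd_of_dvd hJ hd he hde hA hB hPy hPA hQy hQB dvd_rfl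
  exact exists_eq_C_mul_quasiForm_pow_add hd he hde hA hB
    (leadingCoeff_ne_zero.mpr (fiberResultant_ne_zero hd he hA hB hPy hPA hQy hQB)) hn

end

theorem corollary1 (P Q : MvPolynomial (Fin 2) ℂ) (K d e : ℕ) (A B : ℂ)
    (hJ : ∃ c : ℂ, c ≠ 0 ∧ jacobianDet P Q = MvPolynomial.C c)
    (hPdeg : P.totalDegree = K * d) (hQdeg : Q.totalDegree = K * e)
    (hde : Nat.gcd d e = 1)
    (hA : A ≠ 0) (hB : B ≠ 0)
    (hPy : (asPolyInY ℂ P).natDegree = K * d)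
    (hPA : (asPolyInY ℂ P).leadingCoeff = Polynomial.C A)
    (hQy : (asPolyInY ℂ Q).natDegree = K * e)
    (hQB : (asPolyInY ℂ Q).leadingCoeff = Polynomial.C B) :
    ∃ (C : ℂ) (M : ℕ) (S : MvPolynomial (Fin 2) ℂ),
      C ≠ 0 ∧
      (∀ s ∈ S.support, s 0 * d + s 1 * e < M * d * e) ∧
      (resultantY P Q).leadingCoeff =
        MvPolynomial.C C *
          (MvPolynomial.C (B ^ d) * MvPolynomial.X 0 ^ e
            - MvPolynomial.C (A ^ e) * MvPolynomial.X 1 ^ d) ^ M + S := by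
  obtain ⟨c, -, hJ⟩ := hJ
  exact corollary1_general ⟨c, hJ⟩ hde hA hB hPy hPA hQy hQB
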